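/- Let $M$ be a compact connected smooth Riemannian manifold without boundary, and let $m$ be its normalized Lebesgue measure, i.e. the Riemannian volume divided by the total volume of $M$. Let $0<\alpha\le 1$ and let $f_1,\dots,f_d\colon M\to M$ be $C^{1+\alpha}$ local diffeomorphisms, i.e. $C^1$ local diffeomorphisms whose derivatives are locally $\alpha$-Hölder in charts. Let $\Gamma$ be the semigroup generated by $f_1,\dots,f_d$ under composition. For $\omega=\omega_1\omega_2\dots\in\{1,\dots,d\}^{\mathbb N}$ and $n\ge 1$ put $f^n_\omega=f_{\omega_n}\circ\dots\circ f_{\omega_2}\circ f_{\omega_1}$. Suppose that the action of $\Gamma$ is uniformly expanding along an orbital branch: there exist $\omega\in\{1,\dots,d\}^{\mathbb N}$, $\lambda>1$ and $C>0$ such that $$\|Df^n_\omega(x)v\|\ \ge\ C\lambda^n\|v\|\qquad\text{for all } x\in M,\ v\in T_xM \text{ and } n\ge 1.$$ Then the action of $\Gamma$ is ergodic with respect to Lebesgue measure: every Lebesgue measurable set $A\subset M$ with $f(A)\subset A$ for all $f\in\Gamma$ satisfies $m(A)\in\{0,1\}$. -/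

import Mathlib

open scoped Manifold ContDiff NNReal ENNReal Topology
open MeasureTheory Set Bundle

noncomputable section

namespace ExpandingAction

/-- The orbital branch `f^n_w = f_{w_n} ∘ ⋯ ∘ f_{w_1}` of the maps `f_i` along the sequence `w`.
Sequences are indexed from `0`, so `w k` is the `(k+1)`-st letter; `f^0_w` is the identity. -/
def orbitalBranch {M ι : Type*} (f : ι → M → M) (w : ℕ → ι) : ℕ → M → M
  | 0 => id
  | k + 1 => f (w k) ∘ orbitalBranch f w k

/-- The semigroup (under composition) generated by the maps `f_i`. -/
def generatedSemigroup {M ι : Type*} (f : ι → M → M) : Subsemigroup (Function.End M) :=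
  Subsemigroup.closure (range f)

/-- The set `A` is (forward) `Γ`-invariant: `g(A) ⊆ A` for all `g ∈ Γ`. -/
def IsInvariantSet {M : Type*} (Γ : Subsemigroup (Function.End M)) (A : Set M) : Prop :=
  ∀ g ∈ Γ, (g : M → M) '' A ⊆ A

/-- The action of `Γ` is ergodic with respect to the probability measure `m`: every `Γ`-invariant
set that is measurable for the completion of `m` has `m`-measure `0` or `1`. -/
def IsErgodicAction {M : Type*} [MeasurableSpace M] (Γ : Subsemigroup (Function.End M))
    (m : Measure M) : Prop :=
  ∀ A : Set M, NullMeasurableSet A m → IsInvariantSet Γ A → m A = 0 ∨ m A = 1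

section Manifold

variable {n : ℕ} {M : Type*} [TopologicalSpace M] [ChartedSpace (EuclideanSpace ℝ (Fin n)) M]

/-- `f` is a `C^{1+α}` local diffeomorphism of `M`: a `C^1` local diffeomorphism whose derivative,
read in charts around an arbitrary point and its image, is locally `α`-Hölder. -/
structure IsHolderLocalDiffeo (α : ℝ≥0) (f : M → M) : Prop where
  isLocalDiffeomorph : IsLocalDiffeomorph (𝓡 n) (𝓡 n) 1 f
  holder_fderiv : ∀ x : M, ∃ C : ℝ≥0, ∃ U ∈ 𝓝 (extChartAt (𝓡 n) x x),
    HolderOnWith C α (fderiv ℝ (writtenInExtChartAt (𝓡 n) (𝓡 n) x f)) U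

variable [IsManifold (𝓡 n) ∞ M] [RiemannianBundle (fun x : M ↦ TangentSpace (𝓡 n) x)]

/-- The action generated by the `f_i` is uniformly expanding along an orbital branch, for the norm
of the Riemannian metric of `M`. -/
def IsUniformlyExpanding {ι : Type*} (f : ι → M → M) : Prop :=
  ∃ (w : ℕ → ι) (lam C : ℝ), 1 < lam ∧ 0 < C ∧
    ∀ (x : M) (k : ℕ), 1 ≤ k → ∀ v : TangentSpace (𝓡 n) x,
      C * lam ^ k * ‖v‖ ≤ ‖mfderiv (𝓡 n) (𝓡 n) (orbitalBranch f w k) x v‖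

/-- The matrix `(g_{ij})` at the point with coordinates `u` of the Riemannian metric in the
preferred chart around `x`: the inner products of the coordinate vector fields. -/
def metricMatrix (x : M) (u : EuclideanSpace ℝ (Fin n)) : Matrix (Fin n) (Fin n) ℝ :=
  Matrix.of fun i j ↦
    inner ℝ
      (mfderiv (𝓡 n) (𝓡 n) (chartAt (EuclideanSpace ℝ (Fin n)) x).symm u
        (EuclideanSpace.basisFun (Fin n) ℝ i))
      (mfderiv (𝓡 n) (𝓡 n) (chartAt (EuclideanSpace ℝ (Fin n)) x).symm u
        (EuclideanSpace.basisFun (Fin n) ℝ j))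

variable [MeasurableSpace M]

/-- The Riemannian volume of the domain of the preferred chart around `x`, extended by zero to `M`:
the image under the inverse chart of the measure `√det(g_{ij}) du` on the target of the chart. -/
def chartVolume (x : M) : Measure M :=
  ((volume.restrict (chartAt (EuclideanSpace ℝ (Fin n)) x).target).withDensity
    fun u ↦ ENNReal.ofReal (√(metricMatrix x u).det)).map
      (chartAt (EuclideanSpace ℝ (Fin n)) x).symm

variable (n M) in
/-- The Riemannian volume (Lebesgue measure) of `M`. By the change of variables formula the measures
`chartVolume x` agree on the overlaps of the chart domains, so that their supremum is the measure
which coincides with `chartVolume x` on the chart domain around each `x`. -/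
def riemannianVolume : Measure M :=
  ⨆ x : M, chartVolume (n := n) x

variable (n M) in
/-- The normalized Lebesgue measure of `M`. -/
def lebesgueMeasure : Measure M :=
  (riemannianVolume n M univ)⁻¹ • riemannianVolume n M

end Manifold

end ExpandingAction

end

noncomputable section

namespace ExpandingAction


/-! ### Jacobians of locally injective maps and change of variables -/

section Jacobian

variable {M : Type*} [MeasurableSpace M]

/-! Along the expanding branch, take `k` so large that `C * lam ^ k > 1`. Then `g = orbitalBranch f
w k` alone is uniformly expanding, and every set invariant under the semigroup is mapped into itself
by `g`. It suffices that such a set `A` or its complement is null for the Riemannian volume `μ`.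

Three facts about `g` are needed. On a compact manifold a local diffeomorphism is a covering, so
almost shortest paths lift; lifting shortens them, and any two fibers are matched by a bijection
moving points by at most `θ * dist y y'` with `θ < 1` (`exists_fiber_equiv_dist_le`). The map has a
Jacobian `exp ∘ φ` for `μ` (`hasLogJacobian_riemannianVolume` and the chain rule). The function `φ`
is globally `α`-Hölder (`chartHolderAt_log_jacobian`, `exists_holderWith_of_holderNear`).

The rest is bounded distortion, expressed through the transfer operator with weight `exp (-φ)`,
which is dual to composition with `g` and so preserves integrals. By the fiber matching it contracts
log-Hölder constants up to a fixed error. Hence some iterate of any log-Hölder `ψ` has oscillation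
bounded by a factor independent of `ψ` (`LogHolder.exists_iterate_transferOperator`). Since the
complement `B` of `A` satisfies `g ⁻¹' B ⊆ B`, duality shows that `B` carries a fraction of `∫ ψ` at
least a constant times its measure, uniformly in `ψ` (`HasLogJacobian.measure_mul_lintegral_le`).
Letting `ψ` decrease to the indicator of a compact subset `K` of `A` sends the mass of `ψ` on `B` to
`0`, so `B` and `K` cannot both have positive measure. This uniform estimate replaces the usual
argument with density points. -/

/-- The map `g` is locally injective, and `exp ∘ φ` is its Jacobian with respect to `μ`. -/
def HasLogJacobian [TopologicalSpace M] (μ : Measure M) (g : M → M) (φ : M → ℝ) : Prop :=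
  ∀ x, ∃ U ∈ 𝓝 x, InjOn g U ∧ ∀ S ⊆ U, MeasurableSet S →
    μ (g '' S) = ∫⁻ x in S, ENNReal.ofReal (Real.exp (φ x)) ∂μ

/-- Change of variables on a set on which the map is injective. -/
theorem setLIntegral_image_of_logJacobian {μ : Measure M} {g : M → M} {φ : M → ℝ}
    (hg : Measurable g) (hφ : Measurable φ) {S : Set M} (hS : MeasurableSet S)
    (h : ∀ T ⊆ S, MeasurableSet T →
      μ (g '' T) = ∫⁻ x in T, ENNReal.ofReal (Real.exp (φ x)) ∂μ)
    {χ : M → ℝ≥0∞} (hχ : Measurable χ) :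
    ∫⁻ y in g '' S, χ y ∂μ = ∫⁻ x in S, ENNReal.ofReal (Real.exp (φ x)) * χ (g x) ∂μ := by
  have hJ : Measurable fun x ↦ ENNReal.ofReal (Real.exp (φ x)) := by fun_prop
  -- Read on preimages, the Jacobian identity for subsets of `S` says that `g` pushes the weighted
  -- measure on `S` to `μ` on the image; integrating any `χ` is then formal.
  have key : μ.restrict (g '' S) =
      ((μ.restrict S).withDensity fun x ↦ ENNReal.ofReal (Real.exp (φ x))).map g := by
    ext T hT
    rw [Measure.restrict_apply hT, Measure.map_apply hg hT, withDensity_apply _ (hg hT),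
      Measure.restrict_restrict (hg hT), ← h _ inter_subset_right ((hg hT).inter hS),
      image_preimage_inter]
  rw [key, lintegral_map hχ hg, lintegral_withDensity_eq_lintegral_mul _ hJ (by fun_prop)]
  rfl

theorem HasLogJacobian.comp [TopologicalSpace M] [BorelSpace M] {μ : Measure M} {f g : M → M}
    {φ χ : M → ℝ}
    (hg : HasLogJacobian μ g χ) (hf : HasLogJacobian μ f φ) (hfc : Continuous f)
    (hφ : Measurable φ) (hχ : Measurable χ) (hemb : ∀ S, MeasurableSet S → InjOn f S →
      MeasurableSet (f '' S)) :
    HasLogJacobian μ (g ∘ f) (fun x ↦ χ (f x) + φ x) := by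
  intro x
  obtain ⟨U, hU, hUi, hUJ⟩ := hf x
  obtain ⟨V, hV, hVi, hVJ⟩ := hg (f x)
  refine ⟨U ∩ f ⁻¹' V, Filter.inter_mem hU (hfc.continuousAt hV), ?_, ?_⟩
  · exact hVi.comp (hUi.mono inter_subset_left) fun z hz ↦ hz.2
  · intro S hS hSm
    have hSU : S ⊆ U := hS.trans inter_subset_left
    rw [image_comp, hVJ _ (by rintro _ ⟨z, hz, rfl⟩; exact (hS hz).2)
      (hemb S hSm (hUi.mono hSU)),
      setLIntegral_image_of_logJacobian hfc.measurable hφ hSm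
        (fun T hT hTm ↦ hUJ T (hT.trans hSU) hTm) (by fun_prop)]
    refine lintegral_congr fun z ↦ ?_
    rw [← ENNReal.ofReal_mul (Real.exp_pos _).le, ← Real.exp_add, add_comm]

end Jacobian

/-! ### The transfer operator and its duality with composition -/

section TransferOperator

variable {M : Type*}

/-- The transfer operator of `g` with weight `exp (-φ)`. -/
def transferOperator (g : M → M) (φ : M → ℝ) (ψ : M → ℝ≥0∞) (y : M) : ℝ≥0∞ :=
  ∑' x : g ⁻¹' {y}, ENNReal.ofReal (Real.exp (-φ x)) * ψ x

/-- Injectivity on `S` leaves at most one nonzero term in each fiber sum. The form with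
`Function.extend` gives measurability, because the restriction of `g` to `S` is a measurable
embedding. -/
theorem tsum_fiber_indicator_eq_extend {g : M → M} {S : Set M} (hS : InjOn g S)
    (w : M → ℝ≥0∞) (y : M) :
    ∑' x : g ⁻¹' {y}, S.indicator w x =
      Function.extend (fun x : S ↦ g x) (fun x : S ↦ w x) 0 y := by
  by_cases hy : ∃ x : S, g x = y
  · obtain ⟨x, rfl⟩ := hy
    rw [show Function.extend (fun x : S ↦ g x) (fun x : S ↦ w x) 0 (g x) = w x from
      hS.injective.extend_apply (fun x : S ↦ w x) 0 x,
      tsum_eq_single (⟨x, rfl⟩ : g ⁻¹' {g x})]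
    · simp
    · rintro ⟨z, hz⟩ hzx
      refine indicator_of_notMem (fun hzS ↦ hzx ?_) _
      exact Subtype.ext (hS hzS x.2 hz)
  · rw [Function.extend_apply' _ _ _ hy]
    refine ENNReal.tsum_eq_zero.2 fun z ↦ indicator_of_notMem (fun hz ↦ hy ⟨⟨z, hz⟩, z.2⟩) _

theorem transferOperator_eq_tsum {g : M → M} {φ : M → ℝ} {S : ℕ → Set M}
    (hd : Pairwise (Function.onFun Disjoint S)) (hu : (⋃ i, S i) = univ) (ψ : M → ℝ≥0∞) (y : M) :
    transferOperator g φ ψ y = ∑' i, ∑' x : g ⁻¹' {y},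
      (S i).indicator (fun x ↦ ENNReal.ofReal (Real.exp (-φ x)) * ψ x) x := by
  rw [ENNReal.tsum_comm]
  refine tsum_congr fun x ↦ ?_
  obtain ⟨i, hi⟩ := mem_iUnion.1 (hu ▸ mem_univ (x : M))
  rw [tsum_eq_single i, indicator_of_mem hi]
  intro j hj
  exact indicator_of_notMem (fun hxj ↦ (hd hj).le_bot ⟨hxj, hi⟩) _

variable [TopologicalSpace M] [PolishSpace M] [MeasurableSpace M] [BorelSpace M]
  {μ : Measure M} {g : M → M} {φ : M → ℝ}

theorem measurableSet_image_of_injOn (hg : Continuous g) {S : Set M} (hS : MeasurableSet S)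
    (hi : InjOn g S) : MeasurableSet (g '' S) :=
  hS.image_of_continuousOn_injOn hg.continuousOn hi

theorem measurable_tsum_fiber_indicator (hg : Continuous g) {S : Set M} (hSm : MeasurableSet S)
    (hS : InjOn g S) {w : M → ℝ≥0∞} (hw : Measurable w) :
    Measurable fun y ↦ ∑' x : g ⁻¹' {y}, S.indicator w x := by
  simp_rw [tsum_fiber_indicator_eq_extend hS]
  have := hg.continuousOn.measurableEmbedding hSm hS
  exact this.measurable_extend (hw.comp measurable_subtype_coe) measurable_const

/-- Duality on one injective piece: the weight `exp (-φ)` cancels the Jacobian `exp φ` in the change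
of variables. Summing over a countable partition gives the general case. -/
theorem lintegral_tsum_fiber_indicator_mul (hg : Continuous g) (hφ : Measurable φ)
    {S : Set M} (hSm : MeasurableSet S) (hS : InjOn g S)
    (hJ : ∀ T ⊆ S, MeasurableSet T →
      μ (g '' T) = ∫⁻ x in T, ENNReal.ofReal (Real.exp (φ x)) ∂μ)
    {ψ χ : M → ℝ≥0∞} (hψ : Measurable ψ) (hχ : Measurable χ) :
    ∫⁻ y, (∑' x : g ⁻¹' {y},
        S.indicator (fun x ↦ ENNReal.ofReal (Real.exp (-φ x)) * ψ x) x) * χ y ∂μ =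
      ∫⁻ x in S, ψ x * χ (g x) ∂μ := by
  set w : M → ℝ≥0∞ := fun x ↦ ENNReal.ofReal (Real.exp (-φ x)) * ψ x
  have hw : Measurable w := by fun_prop
  have hm := measurable_tsum_fiber_indicator hg hSm hS hw
  -- Off `g '' S` the fiber sum is empty of contributions, so the integral localizes to the image.
  rw [← setLIntegral_eq_of_support_subset (s := g '' S),
    setLIntegral_image_of_logJacobian hg.measurable hφ hSm hJ (by fun_prop)]
  · refine setLIntegral_congr_fun hSm fun x hx ↦ ?_
    rw [tsum_fiber_indicator_eq_extend hS,
      show Function.extend (fun x : S ↦ g x) (fun x : S ↦ w x) 0 (g x) = w x from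
        hS.injective.extend_apply (fun x : S ↦ w x) 0 ⟨x, hx⟩]
    simp only [w]
    rw [← mul_assoc, ← mul_assoc, ← ENNReal.ofReal_mul (Real.exp_pos _).le, ← Real.exp_add]
    simp
  · intro y hy
    by_contra h
    apply hy
    beta_reduce
    rw [tsum_fiber_indicator_eq_extend hS, Function.extend_apply', Pi.zero_apply, zero_mul]
    rintro ⟨x, rfl⟩
    exact h ⟨x, x.2, rfl⟩

/-- A measurable partition into sets where the map is injective and has Jacobian `exp ∘ φ`. -/
theorem HasLogJacobian.exists_partition [Nonempty M] (h : HasLogJacobian μ g φ) :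
    ∃ S : ℕ → Set M, (∀ i, MeasurableSet (S i)) ∧ Pairwise (Function.onFun Disjoint S) ∧
      (⋃ i, S i) = univ ∧ ∀ i, InjOn g (S i) ∧ ∀ T ⊆ S i, MeasurableSet T →
        μ (g '' T) = ∫⁻ x in T, ENNReal.ofReal (Real.exp (φ x)) ∂μ := by
  choose U hU hUi hUJ using h
  obtain ⟨s, hs, hsU⟩ := TopologicalSpace.countable_cover_nhds
    (fun x ↦ interior_mem_nhds.2 (hU x))
  have hne : s.Nonempty := by
    by_contra hs
    rw [not_nonempty_iff_eq_empty] at hs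
    simp [hs] at hsU
    exact empty_ne_univ hsU
  obtain ⟨e, rfl⟩ := hs.exists_eq_range hne
  have hsub : ∀ i, disjointed (fun i ↦ interior (U (e i))) i ⊆ U (e i) :=
    fun i ↦ (disjointed_subset _ i).trans interior_subset
  refine ⟨disjointed fun i ↦ interior (U (e i)),
    fun i ↦ MeasurableSet.disjointed (fun i ↦ isOpen_interior.measurableSet) i,
    disjoint_disjointed _, ?_, fun i ↦ ⟨(hUi _).mono (hsub i), fun T hT hTm ↦
      hUJ _ T (hT.trans (hsub i)) hTm⟩⟩
  rw [iUnion_disjointed]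
  simpa using hsU

variable [Nonempty M]

theorem HasLogJacobian.measurable_transferOperator (h : HasLogJacobian μ g φ)
    (hg : Continuous g) (hφ : Measurable φ) {ψ : M → ℝ≥0∞} (hψ : Measurable ψ) :
    Measurable (transferOperator g φ ψ) := by
  obtain ⟨S, hSm, hd, hu, hS⟩ := h.exists_partition
  rw [show transferOperator g φ ψ = _ from funext (transferOperator_eq_tsum hd hu ψ)]
  exact Measurable.tsum fun i ↦
    measurable_tsum_fiber_indicator hg (hSm i) (hS i).1 (by fun_prop)

/-- The transfer operator is dual to the composition with `g`. -/
theorem HasLogJacobian.lintegral_transferOperator_mul (h : HasLogJacobian μ g φ)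
    (hg : Continuous g) (hφ : Measurable φ) {ψ χ : M → ℝ≥0∞} (hψ : Measurable ψ)
    (hχ : Measurable χ) :
    ∫⁻ y, transferOperator g φ ψ y * χ y ∂μ = ∫⁻ x, ψ x * χ (g x) ∂μ := by
  obtain ⟨S, hSm, hd, hu, hS⟩ := h.exists_partition
  have hm : ∀ i, Measurable fun y ↦ ∑' x : g ⁻¹' {y},
      (S i).indicator (fun x ↦ ENNReal.ofReal (Real.exp (-φ x)) * ψ x) x :=
    fun i ↦ measurable_tsum_fiber_indicator hg (hSm i) (hS i).1 (by fun_prop)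
  have hsum : ∀ y, transferOperator g φ ψ y * χ y = ∑' i, (∑' x : g ⁻¹' {y},
      (S i).indicator (fun x ↦ ENNReal.ofReal (Real.exp (-φ x)) * ψ x) x) * χ y := fun y ↦ by
    rw [transferOperator_eq_tsum hd hu ψ, ENNReal.tsum_mul_right]
  simp_rw [hsum]
  rw [lintegral_tsum fun i ↦ by fun_prop]
  simp_rw [fun i ↦ lintegral_tsum_fiber_indicator_mul hg hφ (hSm i) (hS i).1 (hS i).2 hψ hχ]
  rw [← lintegral_iUnion hSm hd, hu, setLIntegral_univ]

theorem HasLogJacobian.measurable_iterate_transferOperator (h : HasLogJacobian μ g φ)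
    (hg : Continuous g) (hφ : Measurable φ) {ψ : M → ℝ≥0∞} (hψ : Measurable ψ) (k : ℕ) :
    Measurable ((transferOperator g φ)^[k] ψ) := by
  induction k with
  | zero => exact hψ
  | succ k ih =>
    rw [Function.iterate_succ_apply']
    exact h.measurable_transferOperator hg hφ ih

theorem HasLogJacobian.lintegral_iterate_transferOperator_mul (h : HasLogJacobian μ g φ)
    (hg : Continuous g) (hφ : Measurable φ) {ψ χ : M → ℝ≥0∞} (hψ : Measurable ψ)
    (hχ : Measurable χ) (k : ℕ) :
    ∫⁻ y, (transferOperator g φ)^[k] ψ y * χ y ∂μ = ∫⁻ x, ψ x * χ (g^[k] x) ∂μ := by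
  induction k generalizing χ with
  | zero => rfl
  | succ k ih =>
    rw [Function.iterate_succ_apply', h.lintegral_transferOperator_mul hg hφ
      (h.measurable_iterate_transferOperator hg hφ hψ k) hχ,
      ih (χ := fun x ↦ χ (g x)) (by fun_prop)]
    simp only [Function.iterate_succ_apply']

end TransferOperator

/-! ### Log-Hölder cones, bounded distortion and the zero-one alternative -/

section Cone

variable {M : Type*} [MetricSpace M]

/-- The cone of functions whose logarithm is Hölder continuous with constant `a`. -/
def LogHolder (a : ℝ) (α : ℝ≥0) (ψ : M → ℝ≥0∞) : Prop :=
  ∀ x y, ψ x ≤ ENNReal.ofReal (Real.exp (a * dist x y ^ (α : ℝ))) * ψ y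

theorem LogHolder.mono {a b : ℝ} {α : ℝ≥0} {ψ : M → ℝ≥0∞} (h : LogHolder a α ψ) (hab : a ≤ b) :
    LogHolder b α ψ := fun x y ↦ (h x y).trans <| by gcongr

/-- Match the terms of the two fiber sums by `σ`. The logarithms of matched terms differ by at most
`(a + C)` times the `α`-th power of their distance: `a` comes from `ψ`, `C` from the weight. The
contraction by `θ` contributes `θ ^ α`. -/
theorem LogHolder.transferOperator {a θ : ℝ} {C α : ℝ≥0} {g : M → M} {φ : M → ℝ}
    {ψ : M → ℝ≥0∞} (ha : 0 ≤ a) (hθ : 0 ≤ θ) (hψ : LogHolder a α ψ) (hφ : HolderWith C α φ)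
    (hσ : ∀ y y', ∃ σ : g ⁻¹' {y} ≃ g ⁻¹' {y'}, ∀ x : g ⁻¹' {y},
      dist (x : M) (σ x) ≤ θ * dist y y') :
    LogHolder (θ ^ (α : ℝ) * (a + C)) α (transferOperator g φ ψ) := by
  intro y y'
  obtain ⟨σ, hσ⟩ := hσ y y'
  unfold ExpandingAction.transferOperator
  rw [← σ.tsum_eq (fun x : g ⁻¹' {y'} ↦ ENNReal.ofReal (Real.exp (-φ x)) * ψ x),
    ← ENNReal.tsum_mul_left]
  refine ENNReal.tsum_le_tsum fun x ↦ ?_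
  have h1 : dist (x : M) (σ x) ^ (α : ℝ) ≤ θ ^ (α : ℝ) * dist y y' ^ (α : ℝ) := by
    rw [← Real.mul_rpow hθ dist_nonneg]
    exact Real.rpow_le_rpow dist_nonneg (hσ x) α.2
  have h2 : φ (σ x) - φ x ≤ C * dist (x : M) (σ x) ^ (α : ℝ) := by
    have := hφ.dist_le (x : M) (σ x)
    rw [Real.dist_eq, abs_sub_comm] at this
    exact (le_abs_self _).trans this
  calc ENNReal.ofReal (Real.exp (-φ x)) * ψ x
      ≤ ENNReal.ofReal (Real.exp (-φ x)) *
        (ENNReal.ofReal (Real.exp (a * dist (x : M) (σ x) ^ (α : ℝ))) * ψ (σ x)) := by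
        gcongr
        exact hψ _ _
    _ = ENNReal.ofReal (Real.exp (-φ x + a * dist (x : M) (σ x) ^ (α : ℝ))) * ψ (σ x) := by
        rw [← mul_assoc, ← ENNReal.ofReal_mul (Real.exp_pos _).le, ← Real.exp_add]
    _ ≤ ENNReal.ofReal (Real.exp (θ ^ (α : ℝ) * (a + C) * dist y y' ^ (α : ℝ) + -φ (σ x))) *
        ψ (σ x) := by
        refine mul_le_mul_left (ENNReal.ofReal_le_ofReal (Real.exp_le_exp.2 ?_)) _
        have : (a + C) * dist (x : M) (σ x) ^ (α : ℝ) ≤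
            (a + C) * (θ ^ (α : ℝ) * dist y y' ^ (α : ℝ)) := by gcongr
        linarith
    _ = _ := by
        rw [Real.exp_add, ENNReal.ofReal_mul (Real.exp_pos _).le, mul_assoc]

/-- The constant evolves by `a ↦ q * (a + C)` with `q < 1`. The initial `a` influences the number of
iterations but not the final constant, which is what makes the later estimate uniform. -/
theorem LogHolder.exists_iterate_transferOperator {a θ : ℝ} {C α : ℝ≥0} {g : M → M} {φ : M → ℝ}
    {ψ : M → ℝ≥0∞} (ha : 0 ≤ a) (hθ : 0 ≤ θ) (hθ₁ : θ < 1) (hα : 0 < α) (hψ : LogHolder a α ψ)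
    (hφ : HolderWith C α φ)
    (hσ : ∀ y y', ∃ σ : g ⁻¹' {y} ≃ g ⁻¹' {y'}, ∀ x : g ⁻¹' {y},
      dist (x : M) (σ x) ≤ θ * dist y y') :
    ∃ k : ℕ, LogHolder (1 + C / (1 - θ ^ (α : ℝ))) α
      ((ExpandingAction.transferOperator g φ)^[k] ψ) := by
  set q := θ ^ (α : ℝ)
  have hq0 : 0 ≤ q := Real.rpow_nonneg hθ _
  have hq1 : q < 1 := Real.rpow_lt_one hθ hθ₁ (by exact_mod_cast hα)
  have hb : 0 ≤ C / (1 - q) := div_nonneg C.2 (by linarith)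
  -- The value `C / (1 - q)` is not increased by `a ↦ q * (a + C)`, so it serves as an upper
  -- barrier; the excess `q ^ k * a` decays and is eventually absorbed by the summand `1`.
  have hfix : q * (C / (1 - q) + C) ≤ C / (1 - q) := by
    have h : C / (1 - q) * (1 - q) = C := div_mul_cancel₀ _ (by linarith)
    have : q * C ≤ C := mul_le_of_le_one_left C.2 hq1.le
    nlinarith
  have key : ∀ k : ℕ, LogHolder (q ^ k * a + C / (1 - q)) α
      ((ExpandingAction.transferOperator g φ)^[k] ψ) := by
    intro k
    induction k with
    | zero => exact hψ.mono (by simpa using hb)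
    | succ k ih =>
      rw [Function.iterate_succ_apply']
      refine (ih.transferOperator (by positivity) hθ hφ hσ).mono ?_
      rw [pow_succ]
      calc q * (q ^ k * a + C / (1 - q) + C) = q ^ k * q * a + q * (C / (1 - q) + C) := by ring
        _ ≤ _ := by gcongr
  have ht : Filter.Tendsto (fun k : ℕ ↦ q ^ k * a) Filter.atTop (𝓝 0) := by
    simpa using (tendsto_pow_atTop_nhds_zero_of_lt_one hq0 hq1).mul_const a
  obtain ⟨k, hk⟩ := (ht.eventually (eventually_le_nhds zero_lt_one)).exists
  exact ⟨k, (key k).mono (by gcongr)⟩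

variable [CompactSpace M]

/-- The thickened indicator is `δ⁻¹`-Lipschitz and the sum is at least `δ`, so its logarithm is
`δ⁻²`-Lipschitz; bounded diameter turns Lipschitz into `α`-Hölder. The blow-up of the constant as `δ
→ 0` is harmless after iteration. -/
theorem logHolder_thickenedIndicator {α : ℝ≥0} (hα : α ≤ 1) {δ : ℝ} (hδ : 0 < δ) (E : Set M) :
    LogHolder (Metric.diam (univ : Set M) ^ (1 - α : ℝ) / δ ^ 2) α
      (fun x ↦ ENNReal.ofReal δ + thickenedIndicator hδ E x) := by
  intro x y
  set D := Metric.diam (univ : Set M)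
  have hd : dist x y ≤ D :=
    Metric.dist_le_diam_of_mem isCompact_univ.isBounded (mem_univ _) (mem_univ _)
  have h1 : dist x y ≤ D ^ (1 - α : ℝ) * dist x y ^ (α : ℝ) := by
    rcases eq_or_lt_of_le (dist_nonneg (x := x) (y := y)) with h | h
    · rw [← h]
      exact mul_nonneg (Real.rpow_nonneg Metric.diam_nonneg _) (Real.rpow_nonneg le_rfl _)
    · calc dist x y = dist x y ^ (1 - α : ℝ) * dist x y ^ (α : ℝ) := by
            rw [← Real.rpow_add h]; simp
        _ ≤ _ := by
            gcongr
            have : (α : ℝ) ≤ 1 := by exact_mod_cast hα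
            linarith
  set s : ℝ := ((thickenedIndicator hδ E x : ℝ≥0) : ℝ)
  set t : ℝ := ((thickenedIndicator hδ E y : ℝ≥0) : ℝ)
  have ht : 0 ≤ t := NNReal.coe_nonneg _
  have hst : s ≤ t + δ⁻¹ * dist x y := by
    have := (lipschitzWith_thickenedIndicator hδ E).dist_le_mul x y
    rw [NNReal.dist_eq] at this
    have h2 := (le_abs_self _).trans this
    simp only [NNReal.coe_inv, Real.coe_toNNReal _ hδ.le] at h2
    linarith
  have hx : ∀ z, ENNReal.ofReal δ + thickenedIndicator hδ E z =
      ENNReal.ofReal (δ + ((thickenedIndicator hδ E z : ℝ≥0) : ℝ)) := fun z ↦ by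
    rw [ENNReal.ofReal_add hδ.le (NNReal.coe_nonneg _), ENNReal.ofReal_coe_nnreal]
  simp only [hx]
  rw [← ENNReal.ofReal_mul (Real.exp_pos _).le]
  refine ENNReal.ofReal_le_ofReal ?_
  change δ + s ≤ _ * (δ + t)
  set u := D ^ (1 - α : ℝ) / δ ^ 2 * dist x y ^ (α : ℝ)
  have hu : dist x y ≤ u * δ ^ 2 := by
    refine h1.trans_eq ?_
    simp only [u]
    field_simp
  have hu0 : 0 ≤ u := by
    by_contra h
    have := (dist_nonneg (x := x) (y := y)).trans hu
    nlinarith [pow_pos hδ 2]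
  have hu' : δ⁻¹ * dist x y ≤ u * δ := by
    rw [inv_mul_le_iff₀ hδ]
    linarith [hu]
  calc δ + s ≤ δ + t + u * δ := by linarith
    _ ≤ (u + 1) * (δ + t) := by nlinarith
    _ ≤ Real.exp u * (δ + t) := by
        gcongr
        exact Real.add_one_le_exp u

variable [MeasurableSpace M] [BorelSpace M]

/-- Bounded distortion for the transfer operator of an expanding map: the mass of a cone function
on a set with `g ⁻¹' B ⊆ B` is bounded below, uniformly over the cone. -/
theorem HasLogJacobian.measure_mul_lintegral_le [Nonempty M] {μ : Measure M}
    {g : M → M} {φ : M → ℝ} (h : HasLogJacobian μ g φ) (hg : Continuous g) {θ : ℝ} {C α : ℝ≥0}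
    (hθ : 0 ≤ θ) (hθ₁ : θ < 1) (hα : 0 < α) (hφ : HolderWith C α φ)
    (hσ : ∀ y y', ∃ σ : g ⁻¹' {y} ≃ g ⁻¹' {y'}, ∀ x : g ⁻¹' {y},
      dist (x : M) (σ x) ≤ θ * dist y y')
    {B B₀ : Set M} (hB : ∀ x, g x ∈ B → x ∈ B) (hB₀ : MeasurableSet B₀) (hB₀B : B₀ ⊆ B)
    {a : ℝ} (ha : 0 ≤ a) {ψ : M → ℝ≥0∞} (hψm : Measurable ψ) (hψ : LogHolder a α ψ) :
    μ B₀ * ∫⁻ x, ψ x ∂μ ≤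
      ENNReal.ofReal (Real.exp ((1 + C / (1 - θ ^ (α : ℝ))) *
        Metric.diam (univ : Set M) ^ (α : ℝ))) * μ univ * ∫⁻ x, B.indicator ψ x ∂μ := by
  obtain ⟨k, hk⟩ := hψ.exists_iterate_transferOperator ha hθ hθ₁ hα hφ hσ
  have hφm : Measurable φ := (hφ.continuous hα).measurable
  set K := ENNReal.ofReal (Real.exp ((1 + C / (1 - θ ^ (α : ℝ))) *
        Metric.diam (univ : Set M) ^ (α : ℝ)))
  set Ψ := (ExpandingAction.transferOperator g φ)^[k] ψ
  have hΨm : Measurable Ψ := h.measurable_iterate_transferOperator hg hφm hψm k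
  have hq : 0 ≤ 1 + C / (1 - θ ^ (α : ℝ)) := by
    have : θ ^ (α : ℝ) < 1 := Real.rpow_lt_one hθ hθ₁ (by exact_mod_cast hα)
    have := div_nonneg C.2 (by linarith : 0 ≤ 1 - θ ^ (α : ℝ))
    exact add_nonneg zero_le_one this
  have hosc : ∀ x y, Ψ x ≤ K * Ψ y := fun x y ↦ (hk x y).trans <| by
    refine mul_le_mul_left (ENNReal.ofReal_le_ofReal (Real.exp_le_exp.2 ?_)) _
    gcongr
    exact Metric.dist_le_diam_of_mem isCompact_univ.isBounded (mem_univ _) (mem_univ _)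
  have hint : ∫⁻ x, Ψ x ∂μ = ∫⁻ x, ψ x ∂μ := by
    simpa using h.lintegral_iterate_transferOperator_mul hg hφm hψm
      (measurable_const (a := (1 : ℝ≥0∞))) k
  have hpt : ∀ y, ∫⁻ x, Ψ x ∂μ ≤ K * μ univ * Ψ y := fun y ↦ by
    calc ∫⁻ x, Ψ x ∂μ ≤ ∫⁻ x, K * Ψ y ∂μ := lintegral_mono fun x ↦ hosc x y
      _ = K * μ univ * Ψ y := by rw [lintegral_const]; ring
  have hiter : ∀ j x, g^[j] x ∈ B → x ∈ B := by
    intro j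
    induction j with
    | zero => exact fun x hx ↦ hx
    | succ j ih => exact fun x hx ↦ hB x (ih _ hx)
  calc μ B₀ * ∫⁻ x, ψ x ∂μ = ∫⁻ y in B₀, ∫⁻ x, Ψ x ∂μ ∂μ := by
        rw [setLIntegral_const, hint, mul_comm]
    _ ≤ ∫⁻ y in B₀, K * μ univ * Ψ y ∂μ := lintegral_mono fun y ↦ hpt y
    _ = K * μ univ * ∫⁻ y, Ψ y * B₀.indicator 1 y ∂μ := by
        rw [lintegral_const_mul _ hΨm, ← lintegral_indicator hB₀]
        congr 2
        ext y
        by_cases hy : y ∈ B₀ <;> simp [hy]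
    _ = K * μ univ * ∫⁻ x, ψ x * B₀.indicator 1 (g^[k] x) ∂μ := by
        rw [h.lintegral_iterate_transferOperator_mul hg hφm hψm
          (measurable_one.indicator hB₀) k]
    _ ≤ _ := by
        -- Pointwise, `g^[k] x ∈ B₀ ⊆ B` forces `x ∈ B` by backward invariance.
        gcongr with x
        by_cases hx : g^[k] x ∈ B₀
        · simp [hx, hiter k x (hB₀B hx)]
        · simp [hx]

/-- A map with Hölder continuous Jacobian whose inverse branches are globally contracting has no
nontrivial forward invariant sets. -/
theorem HasLogJacobian.measure_eq_zero_or_measure_compl_eq_zero [Nonempty M] {μ : Measure M}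
    [IsFiniteMeasure μ] {g : M → M} {φ : M → ℝ} (h : HasLogJacobian μ g φ) (hg : Continuous g)
    {θ : ℝ} {C α : ℝ≥0} (hθ : 0 ≤ θ) (hθ₁ : θ < 1) (hα : 0 < α) (hα₁ : α ≤ 1)
    (hφ : HolderWith C α φ)
    (hσ : ∀ y y', ∃ σ : g ⁻¹' {y} ≃ g ⁻¹' {y'}, ∀ x : g ⁻¹' {y},
      dist (x : M) (σ x) ≤ θ * dist y y')
    {A : Set M} (hA : NullMeasurableSet A μ) (hgA : MapsTo g A A) :
    μ A = 0 ∨ μ Aᶜ = 0 := by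
  by_contra! hne
  obtain ⟨A₀, hA₀A, hA₀m, hA₀⟩ := hA.exists_measurable_subset_ae_eq
  obtain ⟨B₀, hB₀B, hB₀m, hB₀⟩ := hA.compl.exists_measurable_subset_ae_eq
  -- Inner regularity supplies a compact `K` of positive measure inside `A`; `B₀` is a measurable
  -- core of the complement. The goal is the contradiction `μ B₀ * μ K = 0`.
  obtain ⟨K, hKA, hKc, hK⟩ := hA₀m.exists_lt_isCompact (μ := μ) (r := 0)
    (by rw [measure_congr hA₀]; exact hne.1.bot_lt)
  set c := ENNReal.ofReal (Real.exp ((1 + C / (1 - θ ^ (α : ℝ))) *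
        Metric.diam (univ : Set M) ^ (α : ℝ)))
  have key : ∀ δ : ℝ, 0 < δ → μ B₀ * μ K ≤
      c * μ univ * (ENNReal.ofReal δ * μ univ + (μ (Metric.cthickening δ K) - μ K)) := by
    intro δ hδ
    set ψ : M → ℝ≥0∞ := fun x ↦ ENNReal.ofReal δ + thickenedIndicator hδ K x
    have hψm : Measurable ψ := by
      have := (thickenedIndicator hδ K).continuous.measurable
      fun_prop
    have ha : 0 ≤ Metric.diam (univ : Set M) ^ (1 - α : ℝ) / δ ^ 2 :=
      div_nonneg (Real.rpow_nonneg Metric.diam_nonneg _) (by positivity)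
    have hmain := h.measure_mul_lintegral_le hg hθ hθ₁ hα hφ hσ (B := Aᶜ)
      (fun x hx hxA ↦ hx (hgA hxA)) hB₀m hB₀B ha hψm
      (logHolder_thickenedIndicator hα₁ hδ K)
    have h1 : μ K ≤ ∫⁻ x, ψ x ∂μ := by
      rw [← lintegral_indicator_one hKc.measurableSet]
      refine lintegral_mono fun x ↦ ?_
      by_cases hx : x ∈ K
      · simp only [ψ, thickenedIndicator_one hδ K hx, indicator_of_mem hx]
        simp
      · simp [hx]
    -- Outside `A`, hence outside `K`, the function `ψ` is at most `δ` plus the indicator of the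
    -- shell `cthickening δ K \ K`, whose measure tends to `0` because `K` is closed.
    have h2 : ∫⁻ x, Aᶜ.indicator ψ x ∂μ ≤
        ENNReal.ofReal δ * μ univ + (μ (Metric.cthickening δ K) - μ K) := by
      have hm : MeasurableSet (Metric.cthickening δ K \ K) :=
        Metric.isClosed_cthickening.measurableSet.diff hKc.measurableSet
      rw [← measure_sdiff (Metric.self_subset_cthickening K) hKc.measurableSet.nullMeasurableSet
        (measure_ne_top _ _), ← lintegral_indicator_one hm, ← lintegral_const,
        ← lintegral_add_left measurable_const]
      refine lintegral_mono fun x ↦ ?_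
      by_cases hxA : x ∈ A
      · simp [hxA]
      · have hxK : x ∉ K := fun hx ↦ hxA (hA₀A (hKA hx))
        rw [indicator_of_mem (show x ∈ Aᶜ from hxA)]
        simp only [ψ]
        gcongr
        by_cases hxt : x ∈ Metric.cthickening δ K
        · rw [indicator_of_mem (show x ∈ Metric.cthickening δ K \ K from ⟨hxt, hxK⟩)]
          rw [Pi.one_apply]
          exact_mod_cast thickenedIndicator_le_one hδ K x
        · rw [thickenedIndicator_zero hδ K
            (fun hx ↦ hxt (Metric.thickening_subset_cthickening _ _ hx))]
          simp
    calc μ B₀ * μ K ≤ μ B₀ * ∫⁻ x, ψ x ∂μ := by gcongr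
      _ ≤ _ := hmain
      _ ≤ _ := by gcongr
  have hlim : Filter.Tendsto (fun δ : ℝ ↦ c * μ univ *
      (ENNReal.ofReal δ * μ univ + (μ (Metric.cthickening δ K) - μ K))) (𝓝[>] 0)
      (𝓝 (c * μ univ * (ENNReal.ofReal 0 * μ univ + (μ K - μ K)))) := by
    have hcthick : Filter.Tendsto (fun δ : ℝ ↦ μ (Metric.cthickening δ K)) (𝓝[>] 0) (𝓝 (μ K)) :=
      (tendsto_measure_cthickening_of_isClosed ⟨1, one_pos, measure_ne_top _ _⟩
        hKc.isClosed).mono_left nhdsWithin_le_nhds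
    refine ENNReal.Tendsto.const_mul (Filter.Tendsto.add ?_ ?_) (.inr ?_)
    · refine ENNReal.Tendsto.mul_const ?_ (.inr (measure_ne_top _ _))
      exact (ENNReal.continuous_ofReal.tendsto 0).mono_left nhdsWithin_le_nhds
    · exact ENNReal.Tendsto.sub hcthick tendsto_const_nhds (.inl (measure_ne_top _ _))
    · exact ENNReal.mul_ne_top ENNReal.ofReal_ne_top (measure_ne_top _ _)
  have hzero : μ B₀ * μ K ≤ 0 := by
    have := ge_of_tendsto hlim (Filter.eventually_of_mem self_mem_nhdsWithin key)
    simpa using this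
  rw [nonpos_iff_eq_zero, mul_eq_zero, measure_congr hB₀] at hzero
  exact hzero.elim hne.2 hK.ne'

end Cone


/-! ### Gram determinants and pullbacks of the metric -/

section GramMatrix

variable {n : ℕ}

/-- The Gram determinant is multiplied by the square of the determinant under a change of frame. -/
theorem det_gram_comp {V : Type*} [NormedAddCommGroup V] [InnerProductSpace ℝ V]
    (L : EuclideanSpace ℝ (Fin n) →ₗ[ℝ] V)
    (F : EuclideanSpace ℝ (Fin n) →ₗ[ℝ] EuclideanSpace ℝ (Fin n)) :
    (Matrix.gram ℝ fun i ↦ L (F (EuclideanSpace.basisFun (Fin n) ℝ i))).det =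
      LinearMap.det F ^ 2 *
        (Matrix.gram ℝ fun i ↦ L (EuclideanSpace.basisFun (Fin n) ℝ i)).det := by
  set b := (EuclideanSpace.basisFun (Fin n) ℝ).toBasis
  set A := LinearMap.toMatrix b b F
  have hF : ∀ j, F (EuclideanSpace.basisFun (Fin n) ℝ j) =
      ∑ i, A i j • EuclideanSpace.basisFun (Fin n) ℝ i := fun j ↦ by
    have := (b.sum_repr (F (b j))).symm
    simpa [A, LinearMap.toMatrix_apply, b] using this
  have hG : (Matrix.gram ℝ fun i ↦ L (F (EuclideanSpace.basisFun (Fin n) ℝ i))) =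
      A.transpose * (Matrix.gram ℝ fun i ↦ L (EuclideanSpace.basisFun (Fin n) ℝ i)) * A := by
    ext i j
    simp only [Matrix.gram_apply, Matrix.mul_apply, hF, map_sum, map_smul, sum_inner, inner_sum,
      real_inner_smul_left, real_inner_smul_right, Matrix.transpose_apply, Finset.sum_mul]
    refine Finset.sum_congr rfl fun k _ ↦ Finset.sum_congr rfl fun l _ ↦ ?_
    ring
  rw [hG, Matrix.det_mul, Matrix.det_mul, Matrix.det_transpose, LinearMap.det_toMatrix]
  ring

theorem det_gram_pos {V : Type*} [NormedAddCommGroup V] [InnerProductSpace ℝ V]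
    (L : EuclideanSpace ℝ (Fin n) →ₗ[ℝ] V) (hL : Function.Injective L) :
    0 < (Matrix.gram ℝ fun i ↦ L (EuclideanSpace.basisFun (Fin n) ℝ i)).det := by
  refine (Matrix.posDef_gram_of_linearIndependent ?_).det_pos
  have := (EuclideanSpace.basisFun (Fin n) ℝ).toBasis.linearIndependent.map' L
    (LinearMap.ker_eq_bot.2 hL)
  simpa [Function.comp_def] using this

variable {M : Type*} [TopologicalSpace M] [ChartedSpace (EuclideanSpace ℝ (Fin n)) M]
  [RiemannianBundle (fun x : M ↦ TangentSpace (𝓡 n) x)]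

/-- The matrix at `u` of the pullback of the Riemannian metric under a map `h` to `M`. -/
def pullbackMatrix (h : EuclideanSpace ℝ (Fin n) → M) (u : EuclideanSpace ℝ (Fin n)) :
    Matrix (Fin n) (Fin n) ℝ :=
  Matrix.gram ℝ fun i ↦ mfderiv (𝓡 n) (𝓡 n) h u (EuclideanSpace.basisFun (Fin n) ℝ i)

theorem metricMatrix_eq_pullbackMatrix (x : M) (u : EuclideanSpace ℝ (Fin n)) :
    metricMatrix x u = pullbackMatrix (chartAt (EuclideanSpace ℝ (Fin n)) x).symm u := rfl

/-- The Riemannian inner product at `p` of vectors given in the model space. -/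
def innerAt (p : M) (v w : EuclideanSpace ℝ (Fin n)) : ℝ :=
  inner ℝ (show TangentSpace (𝓡 n) p from v) (show TangentSpace (𝓡 n) p from w)

/-- Writing everything in the fixed model space removes the dependence of the tangent space type on
`h u`, so base point and derivative can be rewritten separately. -/
theorem pullbackMatrix_apply (h : EuclideanSpace ℝ (Fin n) → M) (u : EuclideanSpace ℝ (Fin n))
    (i j : Fin n) : pullbackMatrix h u i j =
      innerAt (h u) ((mfderiv (𝓡 n) (𝓡 n) h u :
          EuclideanSpace ℝ (Fin n) →L[ℝ] EuclideanSpace ℝ (Fin n))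
          (EuclideanSpace.basisFun (Fin n) ℝ i))
        ((mfderiv (𝓡 n) (𝓡 n) h u :
          EuclideanSpace ℝ (Fin n) →L[ℝ] EuclideanSpace ℝ (Fin n))
          (EuclideanSpace.basisFun (Fin n) ℝ j)) := rfl

theorem pullbackMatrix_congr {h k : EuclideanSpace ℝ (Fin n) → M} {u : EuclideanSpace ℝ (Fin n)}
    (hk : h =ᶠ[𝓝 u] k) : pullbackMatrix h u = pullbackMatrix k u := by
  have h1 : h u = k u := hk.self_of_nhds
  have h2 : (mfderiv (𝓡 n) (𝓡 n) h u :
      EuclideanSpace ℝ (Fin n) →L[ℝ] EuclideanSpace ℝ (Fin n)) = mfderiv (𝓡 n) (𝓡 n) k u :=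
    hk.mfderiv_eq
  ext i j
  rw [pullbackMatrix_apply, pullbackMatrix_apply, h1, h2]

theorem det_pullbackMatrix_comp {h : EuclideanSpace ℝ (Fin n) → M}
    {F : EuclideanSpace ℝ (Fin n) → EuclideanSpace ℝ (Fin n)} {u : EuclideanSpace ℝ (Fin n)}
    (hh : MDifferentiableAt (𝓡 n) (𝓡 n) h (F u)) (hF : DifferentiableAt ℝ F u) :
    (pullbackMatrix (h ∘ F) u).det = (fderiv ℝ F u).det ^ 2 * (pullbackMatrix h (F u)).det := by
  have := mfderiv_comp u hh hF.mdifferentiableAt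
  rw [mfderiv_eq_fderiv] at this
  unfold pullbackMatrix
  rw [this]
  exact det_gram_comp (V := TangentSpace (𝓡 n) (h (F u))) (mfderiv (𝓡 n) (𝓡 n) h (F u)).toLinearMap
    (fderiv ℝ F u).toLinearMap

theorem det_pullbackMatrix_pos {h : EuclideanSpace ℝ (Fin n) → M} {u : EuclideanSpace ℝ (Fin n)}
    (hh : Function.Injective (mfderiv (𝓡 n) (𝓡 n) h u)) : 0 < (pullbackMatrix h u).det := by
  exact det_gram_pos (V := TangentSpace (𝓡 n) (h u)) (mfderiv (𝓡 n) (𝓡 n) h u).toLinearMap hh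

variable [IsManifold (𝓡 n) ∞ M]

theorem det_metricMatrix_pos (x : M) {u : EuclideanSpace ℝ (Fin n)}
    (hu : u ∈ (chartAt (EuclideanSpace ℝ (Fin n)) x).target) : 0 < (metricMatrix x u).det := by
  rw [metricMatrix_eq_pullbackMatrix]
  refine det_pullbackMatrix_pos ?_
  exact (mdifferentiable_chart (I := 𝓡 n) x).symm.mfderiv_injective hu

/-- The coordinate fields are images of constant fields under the tangent map of the smooth inverse
chart, and the metric is smooth on smooth sections. -/
theorem contDiffOn_metricMatrix
    [IsContMDiffRiemannianBundle (𝓡 n) ∞ (EuclideanSpace ℝ (Fin n))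
      (fun x : M ↦ TangentSpace (𝓡 n) x)] (x : M) (i j : Fin n) :
    ContDiffOn ℝ ∞ (fun u ↦ metricMatrix x u i j)
      (chartAt (EuclideanSpace ℝ (Fin n)) x).target := by
  set e := chartAt (EuclideanSpace ℝ (Fin n)) x
  have he : ContMDiffOn (𝓡 n) (𝓡 n) ∞ e.symm e.target := contMDiffOn_chart_symm
  have ht : ContMDiffOn (𝓡 n).tangent (𝓡 n).tangent ∞ _ _ :=
    he.contMDiffOn_tangentMapWithin (m := ∞) le_rfl e.open_target.uniqueMDiffOn
  have hb : ∀ i : Fin n, ContMDiffOn (𝓡 n) (𝓡 n).tangent ∞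
      (fun u ↦ (⟨e.symm u, mfderiv (𝓡 n) (𝓡 n) e.symm u (EuclideanSpace.basisFun (Fin n) ℝ i)⟩ :
        TangentBundle (𝓡 n) M)) e.target := by
    intro i
    have hs : ContMDiff (𝓡 n) (𝓡 n).tangent ∞ (fun u : EuclideanSpace ℝ (Fin n) ↦
      (⟨u, EuclideanSpace.basisFun (Fin n) ℝ i⟩ :
        TangentBundle (𝓡 n) (EuclideanSpace ℝ (Fin n)))) := by
      have := (contMDiff_vectorSpace_iff_contDiff (𝕜 := ℝ) (n := ∞) (E := EuclideanSpace ℝ (Fin n))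
        (V := fun _ ↦ EuclideanSpace.basisFun (Fin n) ℝ i)).2 contDiff_const
      exact this
    refine (ht.comp hs.contMDiffOn (fun u hu ↦ hu)).congr fun u hu ↦ ?_
    simp only [Function.comp_apply, tangentMapWithin]
    rw [mfderivWithin_of_isOpen e.open_target hu]
  rw [← contMDiffOn_iff_contDiffOn]
  exact (hb i).inner_bundle (hb j)

end GramMatrix


/-! ### The Riemannian Jacobian in charts -/

section RiemannianJacobian

variable {n : ℕ} {M : Type*} [TopologicalSpace M] [ChartedSpace (EuclideanSpace ℝ (Fin n)) M]

theorem mdifferentiableAt_chartAt_symm [IsManifold (𝓡 n) ∞ M] {x : M} {u : EuclideanSpace ℝ (Fin n)}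
    (hu : u ∈ (chartAt (EuclideanSpace ℝ (Fin n)) x).target) :
    MDifferentiableAt (𝓡 n) (𝓡 n) (chartAt (EuclideanSpace ℝ (Fin n)) x).symm u :=
  mdifferentiableAt_atlas_symm (chart_mem_atlas _ _) hu

theorem mdifferentiableAt_chartAt [IsManifold (𝓡 n) ∞ M] {x z : M}
    (hz : z ∈ (chartAt (EuclideanSpace ℝ (Fin n)) x).source) :
    MDifferentiableAt (𝓡 n) (𝓡 n) (chartAt (EuclideanSpace ℝ (Fin n)) x) z :=
  mdifferentiableAt_atlas (chart_mem_atlas _ _) hz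

/-- The expression of a differentiable map in two charts is differentiable. -/
theorem differentiableAt_chartAt_comp [IsManifold (𝓡 n) ∞ M] {f : M → M} {x y : M} {u : EuclideanSpace ℝ (Fin n)}
    (hu : u ∈ (chartAt (EuclideanSpace ℝ (Fin n)) x).target)
    (hf : MDifferentiableAt (𝓡 n) (𝓡 n) f ((chartAt (EuclideanSpace ℝ (Fin n)) x).symm u))
    (hy : f ((chartAt (EuclideanSpace ℝ (Fin n)) x).symm u) ∈
      (chartAt (EuclideanSpace ℝ (Fin n)) y).source) :
    DifferentiableAt ℝ (chartAt (EuclideanSpace ℝ (Fin n)) y ∘ f ∘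
      (chartAt (EuclideanSpace ℝ (Fin n)) x).symm) u :=
  ((mdifferentiableAt_chartAt hy).comp u
    (hf.comp u (mdifferentiableAt_chartAt_symm hu))).differentiableAt

variable [RiemannianBundle (fun x : M ↦ TangentSpace (𝓡 n) x)]

/-- The Jacobian of `f` at `z` with respect to the Riemannian volume. -/
def jacobian (f : M → M) (z : M) : ℝ :=
  √(pullbackMatrix (f ∘ (chartAt (EuclideanSpace ℝ (Fin n)) z).symm)
      (chartAt (EuclideanSpace ℝ (Fin n)) z z)).det /
    √(metricMatrix z (chartAt (EuclideanSpace ℝ (Fin n)) z z)).det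

variable [IsManifold (𝓡 n) ∞ M]

/-- The pullback of the metric under a map read in the charts around `x` and `y`. -/
theorem sqrt_det_pullbackMatrix_comp_chartAt {f h : M → M} {x y : M} {u : EuclideanSpace ℝ (Fin n)}
    (hu : u ∈ (chartAt (EuclideanSpace ℝ (Fin n)) x).target)
    (hf : MDifferentiableAt (𝓡 n) (𝓡 n) f ((chartAt (EuclideanSpace ℝ (Fin n)) x).symm u))
    (hy : f ((chartAt (EuclideanSpace ℝ (Fin n)) x).symm u) ∈
      (chartAt (EuclideanSpace ℝ (Fin n)) y).source)
    (hh : MDifferentiableAt (𝓡 n) (𝓡 n) h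
      (f ((chartAt (EuclideanSpace ℝ (Fin n)) x).symm u))) :
    √(pullbackMatrix (h ∘ f ∘ (chartAt (EuclideanSpace ℝ (Fin n)) x).symm) u).det =
      |(fderiv ℝ (chartAt (EuclideanSpace ℝ (Fin n)) y ∘ f ∘
        (chartAt (EuclideanSpace ℝ (Fin n)) x).symm) u).det| *
      √(pullbackMatrix (h ∘ (chartAt (EuclideanSpace ℝ (Fin n)) y).symm)
        (chartAt (EuclideanSpace ℝ (Fin n)) y
          (f ((chartAt (EuclideanSpace ℝ (Fin n)) x).symm u)))).det := by
  set e := chartAt (EuclideanSpace ℝ (Fin n)) x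
  set e' := chartAt (EuclideanSpace ℝ (Fin n)) y
  have hcongr : h ∘ f ∘ e.symm =ᶠ[𝓝 u] (h ∘ e'.symm) ∘ (e' ∘ f ∘ e.symm) := by
    have hc : ContinuousAt (f ∘ e.symm) u :=
      hf.continuousAt.comp (e.continuousAt_symm hu)
    filter_upwards [hc (e'.open_source.mem_nhds hy)] with v hv
    exact congrArg h (e'.left_inv hv).symm
  have hd : MDifferentiableAt (𝓡 n) (𝓡 n) (h ∘ e'.symm) ((e' ∘ f ∘ e.symm) u) := by
    refine MDifferentiableAt.comp _ ?_ (mdifferentiableAt_chartAt_symm (e'.map_source hy))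
    simp only [Function.comp_apply]
    rw [e'.left_inv hy]
    exact hh
  rw [pullbackMatrix_congr hcongr,
    det_pullbackMatrix_comp hd (differentiableAt_chartAt_comp hu hf hy),
    Real.sqrt_mul (sq_nonneg _), Real.sqrt_sq_eq_abs]
  rfl

/-- The Jacobian is defined through the preferred chart at each point; this frees it from that
choice. In another chart both square roots acquire the same factor, the absolute determinant of the
transition map. -/
theorem jacobian_mul_sqrt_det_metricMatrix {f : M → M} {x : M} {u : EuclideanSpace ℝ (Fin n)}
    (hu : u ∈ (chartAt (EuclideanSpace ℝ (Fin n)) x).target)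
    (hf : MDifferentiableAt (𝓡 n) (𝓡 n) f ((chartAt (EuclideanSpace ℝ (Fin n)) x).symm u)) :
    jacobian (n := n) f ((chartAt (EuclideanSpace ℝ (Fin n)) x).symm u) *
        √(metricMatrix x u).det =
      √(pullbackMatrix (f ∘ (chartAt (EuclideanSpace ℝ (Fin n)) x).symm) u).det := by
  set e := chartAt (EuclideanSpace ℝ (Fin n)) x
  set z := e.symm u
  have hz : z ∈ (chartAt (EuclideanSpace ℝ (Fin n)) z).source := mem_chart_source _ _
  have h1 := sqrt_det_pullbackMatrix_comp_chartAt (f := id) (h := f) (y := z) hu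
    mdifferentiableAt_id hz hf
  have h2 := sqrt_det_pullbackMatrix_comp_chartAt (f := id) (h := id) (y := z) hu
    mdifferentiableAt_id hz mdifferentiableAt_id
  simp only [Function.id_comp, id] at h1 h2
  change _ = _ * √(pullbackMatrix _ (chartAt (EuclideanSpace ℝ (Fin n)) z z)).det at h1 h2
  have hpos : 0 < √(metricMatrix z (chartAt (EuclideanSpace ℝ (Fin n)) z z)).det :=
    Real.sqrt_pos.2 (det_metricMatrix_pos z (mem_chart_target _ _))
  rw [h1, metricMatrix_eq_pullbackMatrix x u, h2, jacobian, metricMatrix_eq_pullbackMatrix]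
  rw [metricMatrix_eq_pullbackMatrix] at hpos
  field_simp

/-- The Riemannian Jacobian in terms of the expression of the map in charts. -/
theorem jacobian_mul_sqrt_det_metricMatrix_eq {f : M → M} {x y : M}
    {u : EuclideanSpace ℝ (Fin n)}
    (hu : u ∈ (chartAt (EuclideanSpace ℝ (Fin n)) x).target)
    (hf : MDifferentiableAt (𝓡 n) (𝓡 n) f ((chartAt (EuclideanSpace ℝ (Fin n)) x).symm u))
    (hy : f ((chartAt (EuclideanSpace ℝ (Fin n)) x).symm u) ∈
      (chartAt (EuclideanSpace ℝ (Fin n)) y).source) :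
    jacobian (n := n) f ((chartAt (EuclideanSpace ℝ (Fin n)) x).symm u) *
        √(metricMatrix x u).det =
      |(fderiv ℝ (chartAt (EuclideanSpace ℝ (Fin n)) y ∘ f ∘
        (chartAt (EuclideanSpace ℝ (Fin n)) x).symm) u).det| *
      √(metricMatrix y (chartAt (EuclideanSpace ℝ (Fin n)) y
          (f ((chartAt (EuclideanSpace ℝ (Fin n)) x).symm u)))).det := by
  rw [jacobian_mul_sqrt_det_metricMatrix hu hf]
  have := sqrt_det_pullbackMatrix_comp_chartAt (h := id) hu hf hy mdifferentiableAt_id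
  simpa only [Function.id_comp, metricMatrix_eq_pullbackMatrix] using this

theorem jacobian_id (z : M) : jacobian (n := n) id z = 1 := by
  have hpos : 0 < √(metricMatrix z (chartAt (EuclideanSpace ℝ (Fin n)) z z)).det :=
    Real.sqrt_pos.2 (det_metricMatrix_pos z (mem_chart_target _ _))
  rw [jacobian, Function.id_comp, ← metricMatrix_eq_pullbackMatrix, div_self hpos.ne']

theorem jacobian_pos {f : M → M} {z : M} (hf : MDifferentiableAt (𝓡 n) (𝓡 n) f z)
    (hi : Function.Injective (mfderiv (𝓡 n) (𝓡 n) f z)) : 0 < jacobian (n := n) f z := by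
  set e := chartAt (EuclideanSpace ℝ (Fin n)) z
  have ht : e z ∈ e.target := mem_chart_target _ _
  have hz : e.symm (e z) = z := e.left_inv (mem_chart_source _ _)
  refine div_pos (Real.sqrt_pos.2 (det_pullbackMatrix_pos ?_))
    (Real.sqrt_pos.2 (det_metricMatrix_pos z ht))
  rw [mfderiv_comp (I' := 𝓡 n) (e z) (by rw [hz]; exact hf) (mdifferentiableAt_chartAt_symm ht)]
  rw [ContinuousLinearMap.coe_comp]
  refine Function.Injective.comp ?_
    ((mdifferentiable_chart (I := 𝓡 n) z).symm.mfderiv_injective ht)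
  rw [hz]
  exact hi

theorem _root_.IsLocalDiffeomorph.jacobian_pos {f : M → M}
    (hf : IsLocalDiffeomorph (𝓡 n) (𝓡 n) 1 f) (z : M) : 0 < jacobian (n := n) f z := by
  refine ExpandingAction.jacobian_pos (hf.mdifferentiable one_ne_zero z) ?_
  rw [← hf.mfderivToContinuousLinearEquiv_coe one_ne_zero z]
  exact (hf.mfderivToContinuousLinearEquiv one_ne_zero z).injective

end RiemannianJacobian


/-! ### The Riemannian volume and its Jacobian formula -/

section Volume

variable {n : ℕ} {M : Type*} [TopologicalSpace M] [ChartedSpace (EuclideanSpace ℝ (Fin n)) M]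
  [RiemannianBundle (fun x : M ↦ TangentSpace (𝓡 n) x)]

theorem chartVolume_compl_source [MeasurableSpace M] [BorelSpace M] (x : M) :
    chartVolume (n := n) x (chartAt (EuclideanSpace ℝ (Fin n)) x).sourceᶜ = 0 := by
  set e := chartAt (EuclideanSpace ℝ (Fin n)) x
  have hT : MeasurableSet e.target := e.open_target.measurableSet
  have hs : AEMeasurable e.symm (volume.restrict e.target) :=
    e.continuousOn_symm.aemeasurable hT
  rw [chartVolume, Measure.map_apply_of_aemeasurable
    (hs.mono_ac (withDensity_absolutelyContinuous _ _)) e.open_source.measurableSet.compl]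
  refine withDensity_absolutelyContinuous _ _ ?_
  rw [Measure.restrict_apply₀' hT.nullMeasurableSet]
  refine measure_mono_null (t := ∅) ?_ measure_empty
  rintro u ⟨hu, hut⟩
  exact hu (e.map_target hut)

theorem chartVolume_le_riemannianVolume [MeasurableSpace M] (x : M) :
    chartVolume (n := n) x ≤ riemannianVolume n M :=
  le_iSup (fun x : M ↦ chartVolume (n := n) x) x

variable [IsManifold (𝓡 n) ∞ M] [IsContMDiffRiemannianBundle (𝓡 n) ∞ (EuclideanSpace ℝ (Fin n))
    (fun x : M ↦ TangentSpace (𝓡 n) x)]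

theorem contDiffOn_det_metricMatrix (x : M) :
    ContDiffOn ℝ ∞ (fun u ↦ (metricMatrix x u).det)
      (chartAt (EuclideanSpace ℝ (Fin n)) x).target := by
  simp only [Matrix.det_apply]
  refine ContDiffOn.sum fun σ _ ↦ ContDiffOn.const_smul _ (contDiffOn_prod fun i _ ↦ ?_)
  exact contDiffOn_metricMatrix x _ _

theorem continuousOn_sqrt_det_metricMatrix (x : M) :
    ContinuousOn (fun u ↦ √(metricMatrix x u).det)
      (chartAt (EuclideanSpace ℝ (Fin n)) x).target :=
  (contDiffOn_det_metricMatrix x).continuousOn.sqrt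

variable [PolishSpace M] [MeasurableSpace M] [BorelSpace M]

/-- Integration over a subset of a chart domain. -/
theorem setLIntegral_chartVolume (x : M) {S : Set M} (hS : MeasurableSet S)
    (hSx : S ⊆ (chartAt (EuclideanSpace ℝ (Fin n)) x).source) {g : M → ℝ≥0∞}
    (hg : Measurable g) :
    ∫⁻ z in S, g z ∂(chartVolume (n := n) x) =
      ∫⁻ u in chartAt (EuclideanSpace ℝ (Fin n)) x '' S,
        ENNReal.ofReal √(metricMatrix x u).det *
          g ((chartAt (EuclideanSpace ℝ (Fin n)) x).symm u) := by
  set e := chartAt (EuclideanSpace ℝ (Fin n)) x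
  have hT : MeasurableSet e.target := e.open_target.measurableSet
  have hd : AEMeasurable (fun u ↦ ENNReal.ofReal √(metricMatrix x u).det)
      (volume.restrict e.target) :=
    ((continuousOn_sqrt_det_metricMatrix x).aemeasurable hT).ennreal_ofReal
  have hs : AEMeasurable e.symm (volume.restrict e.target) :=
    e.continuousOn_symm.aemeasurable hT
  have heS : MeasurableSet (e '' S) :=
    hS.image_of_continuousOn_injOn (e.continuousOn.mono hSx) (e.injOn.mono hSx)
  have hind : Measurable (S.indicator g) := hg.indicator hS
  rw [← lintegral_indicator hS, chartVolume,
    lintegral_map' hind.aemeasurable (hs.mono_ac (withDensity_absolutelyContinuous _ _)),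
    lintegral_withDensity_eq_lintegral_mul₀ hd
      (g := fun u ↦ S.indicator g (e.symm u)) (hind.comp_aemeasurable hs),
    ← lintegral_indicator hT, ← lintegral_indicator heS]
  refine lintegral_congr fun u ↦ ?_
  by_cases hu : u ∈ e '' S
  · obtain ⟨z, hz, rfl⟩ := hu
    rw [indicator_of_mem (e.map_source (hSx hz)), indicator_of_mem (mem_image_of_mem _ hz)]
    simp [e.left_inv (hSx hz), hz]
  · rw [indicator_of_notMem hu]
    by_cases hut : u ∈ e.target
    · have : e.symm u ∉ S := fun h ↦ hu ⟨_, h, e.right_inv hut⟩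
      simp [hut, this]
    · simp [hut]

theorem chartVolume_apply_of_subset (x : M) {S : Set M} (hS : MeasurableSet S)
    (hSx : S ⊆ (chartAt (EuclideanSpace ℝ (Fin n)) x).source) :
    chartVolume (n := n) x S = ∫⁻ u in chartAt (EuclideanSpace ℝ (Fin n)) x '' S,
        ENNReal.ofReal √(metricMatrix x u).det := by
  simpa using setLIntegral_chartVolume x hS hSx (measurable_const (a := (1 : ℝ≥0∞)))

/-- Change of variables between charts. -/
theorem chartVolume_image {f : M → M} {x y : M} {S : Set M} (hS : MeasurableSet S)
    (hSx : S ⊆ (chartAt (EuclideanSpace ℝ (Fin n)) x).source)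
    (hSy : f '' S ⊆ (chartAt (EuclideanSpace ℝ (Fin n)) y).source)
    (hf : ∀ z ∈ S, MDifferentiableAt (𝓡 n) (𝓡 n) f z) (hi : InjOn f S)
    (hJ : Measurable (jacobian (n := n) f)) :
    chartVolume (n := n) y (f '' S) =
      ∫⁻ z in S, ENNReal.ofReal (jacobian (n := n) f z) ∂(chartVolume (n := n) x) := by
  set e := chartAt (EuclideanSpace ℝ (Fin n)) x
  set e' := chartAt (EuclideanSpace ℝ (Fin n)) y
  have hfS : MeasurableSet (f '' S) := hS.image_of_continuousOn_injOn
    (fun z hz ↦ (hf z hz).continuousAt.continuousWithinAt) hi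
  have heS : MeasurableSet (e '' S) :=
    hS.image_of_continuousOn_injOn (e.continuousOn.mono hSx) (e.injOn.mono hSx)
  rw [chartVolume_apply_of_subset y hfS hSy,
    setLIntegral_chartVolume x hS hSx (by fun_prop)]
  have himage : e' '' (f '' S) = (e' ∘ f ∘ e.symm) '' (e '' S) := by
    simp only [image_image, Function.comp_apply]
    exact image_congr fun z hz ↦ by rw [e.left_inv (hSx hz)]
  have hmem : ∀ u ∈ e '' S, u ∈ e.target ∧ e.symm u ∈ S := by
    rintro _ ⟨z, hz, rfl⟩
    exact ⟨e.map_source (hSx hz), by rwa [e.left_inv (hSx hz)]⟩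
  have hinj : InjOn (e' ∘ f ∘ e.symm) (e '' S) := by
    refine (e'.injOn.mono hSy).comp (t := f '' S) (hi.comp (t := S) ?_ ?_) ?_
    · exact e.symm.injOn.mono fun u hu ↦ (hmem u hu).1
    · exact fun u hu ↦ (hmem u hu).2
    · exact fun u hu ↦ mem_image_of_mem f (hmem u hu).2
  rw [himage, lintegral_image_eq_lintegral_abs_det_fderiv_mul volume heS
    (f' := fderiv ℝ (e' ∘ f ∘ e.symm)) (fun u hu ↦ (differentiableAt_chartAt_comp (hmem u hu).1
      (hf _ (hmem u hu).2)
      (hSy (mem_image_of_mem f (hmem u hu).2))).hasFDerivAt.hasFDerivWithinAt) hinj]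
  refine setLIntegral_congr_fun heS fun u hu ↦ ?_
  have := jacobian_mul_sqrt_det_metricMatrix_eq (y := y) (hmem u hu).1
    (hf _ (hmem u hu).2) (hSy (mem_image_of_mem f (hmem u hu).2))
  rw [← ENNReal.ofReal_mul (abs_nonneg _), ← ENNReal.ofReal_mul (Real.sqrt_nonneg _),
    mul_comm √_]
  exact congrArg _ this.symm

/-- This is the change of variables for the identity map, whose Jacobian is `1`. -/
theorem chartVolume_eq_of_subset {x y : M} {S : Set M} (hS : MeasurableSet S)
    (hSx : S ⊆ (chartAt (EuclideanSpace ℝ (Fin n)) x).source)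
    (hSy : S ⊆ (chartAt (EuclideanSpace ℝ (Fin n)) y).source) :
    chartVolume (n := n) y S = chartVolume (n := n) x S := by
  have h1 : jacobian (n := n) (id : M → M) = fun _ ↦ 1 := funext jacobian_id
  have := chartVolume_image (f := id) (x := x) (y := y) hS hSx (by simpa using hSy)
    (fun z _ ↦ mdifferentiableAt_id) (injOn_id S) (by rw [h1]; exact measurable_const)
  simpa [h1] using this

theorem riemannianVolume_apply_of_subset (x : M) {S : Set M} (hS : MeasurableSet S)
    (hSx : S ⊆ (chartAt (EuclideanSpace ℝ (Fin n)) x).source) :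
    riemannianVolume n M S = chartVolume (n := n) x S := by
  refine le_antisymm ?_ (chartVolume_le_riemannianVolume x S)
  set U := (chartAt (EuclideanSpace ℝ (Fin n)) x).source
  have hU : MeasurableSet U := (chartAt _ x).open_source.measurableSet
  -- A supremum of measures is not computed setwise, so it is bounded by one explicit measure. Sets
  -- leaving `U` have infinite `ν`-measure, and on sets inside `U` every chart volume is dominated
  -- by that of `x`.
  let ν : Measure M := chartVolume (n := n) x + ((⊤ : ℝ≥0∞) • Measure.count).restrict Uᶜ
  have hν : riemannianVolume n M ≤ ν := by
    refine iSup_le fun y ↦ Measure.le_iff.2 fun T hT ↦ ?_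
    rcases (T ∩ Uᶜ).eq_empty_or_nonempty with h | h
    · have hTU : T ⊆ U := fun z hz ↦ by
        by_contra hzU
        exact h.subset (show z ∈ T ∩ Uᶜ from ⟨hz, hzU⟩)
      set V := (chartAt (EuclideanSpace ℝ (Fin n)) y).source
      have hV : MeasurableSet V := (chartAt _ y).open_source.measurableSet
      calc chartVolume (n := n) y T = chartVolume (n := n) y (T ∩ V) := by
            refine le_antisymm ?_ (measure_mono inter_subset_left)
            calc chartVolume (n := n) y T ≤ chartVolume (n := n) y ((T ∩ V) ∪ Vᶜ) :=
                  measure_mono fun z hz ↦ by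
                    by_cases hzV : z ∈ V
                    exacts [.inl ⟨hz, hzV⟩, .inr hzV]
              _ ≤ _ := (measure_union_le _ _).trans_eq (by rw [chartVolume_compl_source, add_zero])
        _ = chartVolume (n := n) x (T ∩ V) := chartVolume_eq_of_subset (hT.inter hV)
            (inter_subset_left.trans hTU) inter_subset_right
        _ ≤ chartVolume (n := n) x T := measure_mono inter_subset_left
        _ ≤ ν T := by simp [ν]
    · have : ν T = ⊤ := by
        have hc : Measure.count (T ∩ Uᶜ) ≠ 0 := by
          rw [Ne, Measure.count_eq_zero_iff]
          exact h.ne_empty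
        simp only [ν, Measure.add_apply, Measure.restrict_apply hT, Measure.smul_apply,
          smul_eq_mul]
        rw [ENNReal.top_mul hc, add_top]
      rw [this]
      exact le_top
  calc riemannianVolume n M S ≤ ν S := hν S
    _ = chartVolume (n := n) x S := by
      have : S ∩ Uᶜ = ∅ := by
        rw [← sdiff_eq, sdiff_eq_empty]
        exact hSx
      simp [ν, Measure.restrict_apply hS, this]

theorem setLIntegral_riemannianVolume (x : M) {S : Set M} (hS : MeasurableSet S)
    (hSx : S ⊆ (chartAt (EuclideanSpace ℝ (Fin n)) x).source) (g : M → ℝ≥0∞) :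
    ∫⁻ z in S, g z ∂(riemannianVolume n M) = ∫⁻ z in S, g z ∂(chartVolume (n := n) x) := by
  congr 1
  ext T hT
  rw [Measure.restrict_apply hT, Measure.restrict_apply hT,
    riemannianVolume_apply_of_subset x (hT.inter hS) (inter_subset_right.trans hSx)]

instance isLocallyFiniteMeasure_riemannianVolume :
    IsLocallyFiniteMeasure (riemannianVolume n M) := by
  refine ⟨fun x ↦ ?_⟩
  set e := chartAt (EuclideanSpace ℝ (Fin n)) x
  have hx : x ∈ e.source := mem_chart_source _ _
  have hc : ContinuousAt (fun u ↦ √(metricMatrix x u).det) (e x) :=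
    (continuousOn_sqrt_det_metricMatrix x).continuousAt (e.open_target.mem_nhds (e.map_source hx))
  set R := √(metricMatrix x (e x)).det + 1
  obtain ⟨r, hr, hrU⟩ := Metric.mem_nhds_iff.1 (Filter.inter_mem
    (hc (Iio_mem_nhds (lt_add_one _))) (e.open_target.mem_nhds (e.map_source hx)))
  have ho : IsOpen (e.source ∩ e ⁻¹' Metric.ball (e x) r) :=
    e.isOpen_inter_preimage Metric.isOpen_ball
  refine ⟨_, ho.mem_nhds ⟨hx, Metric.mem_ball_self hr⟩, ?_⟩
  rw [riemannianVolume_apply_of_subset x ho.measurableSet inter_subset_left,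
    chartVolume_apply_of_subset x ho.measurableSet inter_subset_left]
  have himg : e '' (e.source ∩ e ⁻¹' Metric.ball (e x) r) ⊆ Metric.ball (e x) r := by
    rintro _ ⟨z, hz, rfl⟩
    exact hz.2
  calc ∫⁻ u in e '' (e.source ∩ e ⁻¹' Metric.ball (e x) r), ENNReal.ofReal √(metricMatrix x u).det
      ≤ ∫⁻ u in Metric.ball (e x) r, ENNReal.ofReal √(metricMatrix x u).det :=
        lintegral_mono_set himg
    _ ≤ ∫⁻ u in Metric.ball (e x) r, ENNReal.ofReal R :=
        setLIntegral_mono' measurableSet_ball fun u hu ↦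
          ENNReal.ofReal_le_ofReal (le_of_lt (hrU hu).1)
    _ < ⊤ := by
        rw [setLIntegral_const]
        exact ENNReal.mul_lt_top ENNReal.ofReal_lt_top measure_ball_lt_top

theorem riemannianVolume_univ_ne_zero [Nonempty M] : riemannianVolume n M univ ≠ 0 := by
  obtain ⟨x⟩ := ‹Nonempty M›
  set e := chartAt (EuclideanSpace ℝ (Fin n)) x
  have hT : MeasurableSet e.target := e.open_target.measurableSet
  refine fun h0 ↦ ?_
  have h1 : riemannianVolume n M e.source = 0 := measure_mono_null (subset_univ _) h0
  rw [riemannianVolume_apply_of_subset x e.open_source.measurableSet Subset.rfl,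
    chartVolume_apply_of_subset x e.open_source.measurableSet Subset.rfl,
    e.image_source_eq_target, lintegral_eq_zero_iff'
      ((continuousOn_sqrt_det_metricMatrix x).aemeasurable hT).ennreal_ofReal] at h1
  have h2 : ∀ᵐ u ∂(volume.restrict e.target), False := by
    filter_upwards [h1, ae_restrict_mem hT] with u hu huT
    rw [Pi.zero_apply, ENNReal.ofReal_eq_zero] at hu
    exact (Real.sqrt_pos.2 (det_metricMatrix_pos x huT)).not_ge hu
  have h3 : volume e.target = 0 := by
    have := ae_iff.1 h2
    simpa using this
  exact e.open_target.measure_ne_zero volume ⟨e x, mem_chart_target _ _⟩ h3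

/-- Near each point, shrink to a set where `f` is injective and which lies, with its image, in
single chart domains; there the volume is a chart volume. -/
theorem hasLogJacobian_riemannianVolume {f : M → M}
    (hf : IsLocalDiffeomorph (𝓡 n) (𝓡 n) 1 f) (hJ : Measurable (jacobian (n := n) f)) :
    HasLogJacobian (riemannianVolume n M) f (fun z ↦ Real.log (jacobian (n := n) f z)) := by
  intro x
  set e := chartAt (EuclideanSpace ℝ (Fin n)) x
  set e' := chartAt (EuclideanSpace ℝ (Fin n)) (f x)
  have hd := hf.mdifferentiable one_ne_zero
  obtain ⟨Φ, hΦx, hΦ⟩ := hf x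
  refine ⟨Φ.source ∩ (e.source ∩ f ⁻¹' e'.source), Filter.inter_mem
    (Φ.open_source.mem_nhds hΦx) (Filter.inter_mem (chart_source_mem_nhds _ _)
      (hd.continuous.continuousAt (chart_source_mem_nhds _ _))), ?_, fun S hS hSm ↦ ?_⟩
  · refine InjOn.mono inter_subset_left ?_
    exact (Φ.injOn.congr hΦ.symm)
  · have hSi : InjOn f S := (Φ.injOn.congr hΦ.symm).mono (hS.trans inter_subset_left)
    have hSe : S ⊆ e.source := fun z hz ↦ (hS hz).2.1
    have hSe' : f '' S ⊆ e'.source := by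
      rintro _ ⟨z, hz, rfl⟩
      exact (hS hz).2.2
    have hfS : MeasurableSet (f '' S) :=
      hSm.image_of_continuousOn_injOn hd.continuous.continuousOn hSi
    rw [riemannianVolume_apply_of_subset (f x) hfS hSe',
      setLIntegral_riemannianVolume x hSm hSe,
      chartVolume_image hSm hSe hSe' (fun z _ ↦ hd z) hSi hJ]
    refine lintegral_congr fun z ↦ ?_
    rw [Real.exp_log (hf.jacobian_pos z)]

end Volume


/-! ### Local Hölder continuity and its globalization -/

section LocalHolder

variable {X Y Z : Type*} [PseudoEMetricSpace X] [PseudoEMetricSpace Y] [PseudoEMetricSpace Z]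

/-- `h` is Hölder continuous of exponent `α` on a neighborhood of `p`. -/
def HolderNear (α : ℝ≥0) (h : X → Y) (p : X) : Prop :=
  ∃ C : ℝ≥0, ∃ U ∈ 𝓝 p, HolderOnWith C α h U

variable {α : ℝ≥0} {p : X}

theorem HolderNear.congr {h k : X → Y} (hh : HolderNear α h p) (hk : h =ᶠ[𝓝 p] k) :
    HolderNear α k p := by
  obtain ⟨C, U, hU, hC⟩ := hh
  refine ⟨C, U ∩ {z | h z = k z}, Filter.inter_mem hU hk, fun x hx y hy ↦ ?_⟩
  rw [← show h x = k x from hx.2, ← show h y = k y from hy.2]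
  exact hC x hx.1 y hy.1

theorem HolderNear.continuousAt {h : X → Y} (hh : HolderNear α h p) (hα : 0 < α) :
    ContinuousAt h p := by
  obtain ⟨C, U, hU, hC⟩ := hh
  exact (hC.continuousOn hα).continuousAt hU

theorem HolderNear.lipschitz_comp {h : X → Y} {g : Y → Z} (hα : 0 < α) (hg : HolderNear 1 g (h p))
    (hh : HolderNear α h p) : HolderNear α (g ∘ h) p := by
  have hc := hh.continuousAt hα
  obtain ⟨C, U, hU, hC⟩ := hh
  obtain ⟨D, V, hV, hD⟩ := hg
  have := hD.comp (hC.mono (inter_subset_left (t := h ⁻¹' V))) (fun z hz ↦ hz.2)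
  rw [one_mul] at this
  exact ⟨_, _, Filter.inter_mem hU (hc hV), this⟩

theorem HolderNear.comp_lipschitz {h : X → Y} {g : Y → Z} (hg : HolderNear α g (h p))
    (hh : HolderNear 1 h p) : HolderNear α (g ∘ h) p := by
  have hc := hh.continuousAt one_pos
  obtain ⟨C, U, hU, hC⟩ := hh
  obtain ⟨D, V, hV, hD⟩ := hg
  have := hD.comp (hC.mono (inter_subset_left (t := h ⁻¹' V))) (fun z hz ↦ hz.2)
  rw [mul_one] at this
  exact ⟨_, _, Filter.inter_mem hU (hc hV), this⟩

theorem HolderNear.of_one {h : X → Y} (hα : α ≤ 1) (hh : HolderNear 1 h p) :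
    HolderNear α h p := by
  obtain ⟨C, U, hU, hC⟩ := hh
  refine ⟨_, U ∩ Metric.eball p 1, Filter.inter_mem hU (Metric.eball_mem_nhds p one_pos),
    (hC.mono inter_subset_left).of_le (D := 2) (fun x hx y hy ↦ ?_) hα⟩
  calc edist x y ≤ edist x p + edist y p := edist_triangle_right _ _ _
    _ ≤ 1 + 1 := add_le_add (Metric.mem_eball.1 hx.2).le (Metric.mem_eball.1 hy.2).le
    _ = ((2 : ℝ≥0) : ℝ≥0∞) := by norm_num

theorem HolderNear.add {h k : X → ℝ} (hh : HolderNear α h p) (hk : HolderNear α k p) :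
    HolderNear α (fun x ↦ h x + k x) p := by
  obtain ⟨C, U, hU, hC⟩ := hh
  obtain ⟨D, V, hV, hD⟩ := hk
  refine ⟨C + D, U ∩ V, Filter.inter_mem hU hV, fun x hx y hy ↦ ?_⟩
  calc edist (h x + k x) (h y + k y) ≤ edist (h x) (h y) + edist (k x) (k y) :=
      edist_add_add_le _ _ _ _
    _ ≤ C * edist x y ^ (α : ℝ) + D * edist x y ^ (α : ℝ) :=
      add_le_add (hC x hx.1 y hy.1) (hD x hx.2 y hy.2)
    _ = _ := by push_cast; rw [add_mul]

theorem HolderNear.neg {h : X → ℝ} (hh : HolderNear α h p) :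
    HolderNear α (fun x ↦ -h x) p := by
  obtain ⟨C, U, hU, hC⟩ := hh
  refine ⟨C, U, hU, fun x hx y hy ↦ ?_⟩
  rw [edist_neg_neg]
  exact hC x hx y hy

theorem _root_.ContDiffAt.holderNear_one {E F : Type*} [NormedAddCommGroup E] [NormedSpace ℝ E]
    [NormedAddCommGroup F] [NormedSpace ℝ F] {h : E → F} {p : E} (hh : ContDiffAt ℝ 1 h p) :
    HolderNear 1 h p := by
  obtain ⟨K, t, ht, hK⟩ := hh.exists_lipschitzOnWith
  exact ⟨K, t, ht, holderOnWith_one.2 hK⟩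

/-- A function on a compact metric space that is locally Hölder continuous is Hölder continuous. -/
theorem exists_holderWith_of_holderNear {X : Type*} [MetricSpace X] [CompactSpace X]
    {α : ℝ≥0} (hα : 0 < α) {h : X → ℝ} (hh : ∀ x, HolderNear α h x) :
    ∃ C, HolderWith C α h := by
  have hcont : Continuous h := continuous_iff_continuousAt.2 fun x ↦ (hh x).continuousAt hα
  choose C U hU hC using hh
  obtain ⟨t, ht⟩ := finite_cover_nhds fun x ↦ interior_mem_nhds.2 (hU x)
  obtain ⟨δ, hδ, hL⟩ := lebesgue_number_lemma_of_metric (s := univ) isCompact_univ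
    (c := fun x : t ↦ interior (U x)) (fun _ ↦ isOpen_interior) fun z _ ↦ by
      have hz : z ∈ ⋃ x ∈ t, interior (U x) := ht ▸ mem_univ z
      simpa using hz
  obtain ⟨R, hR⟩ := isCompact_univ.exists_bound_of_continuousOn hcont.continuousOn
  -- Points closer than the Lebesgue number `δ` lie in one member of the cover, with constant at
  -- most `t.sup C`. Farther points use the bound `2 * R` on the oscillation, divided by `δ ^ α`.
  set D : ℝ≥0 := t.sup C + (2 * R * (δ ^ (α : ℝ))⁻¹).toNNReal
  refine ⟨D, fun x y ↦ ?_⟩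
  have hδα : 0 < δ ^ (α : ℝ) := Real.rpow_pos_of_pos hδ _
  rcases lt_or_ge (dist y x) δ with hxy | hxy
  · obtain ⟨i, hi⟩ := hL x (mem_univ x)
    refine (hC i x (interior_subset (hi (Metric.mem_ball_self hδ))) y
      (interior_subset (hi hxy))).trans ?_
    gcongr
    exact (Finset.le_sup i.2).trans (le_add_of_nonneg_right (by positivity))
  · rw [edist_dist, edist_dist, ENNReal.ofReal_rpow_of_nonneg dist_nonneg (NNReal.coe_nonneg α),
      ← ENNReal.ofReal_coe_nnreal, ← ENNReal.ofReal_mul (NNReal.coe_nonneg D)]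
    refine ENNReal.ofReal_le_ofReal ?_
    have hx := hR x (mem_univ x)
    have hy := hR y (mem_univ y)
    have h1 : dist (h x) (h y) ≤ 2 * R := by
      rw [dist_eq_norm]
      exact (norm_sub_le _ _).trans (by linarith)
    have h2 : δ ^ (α : ℝ) ≤ dist x y ^ (α : ℝ) := by
      rw [dist_comm x y]
      exact Real.rpow_le_rpow hδ.le hxy α.2
    have hR0 : 0 ≤ 2 * R := dist_nonneg.trans h1
    calc dist (h x) (h y) ≤ 2 * R * (δ ^ (α : ℝ))⁻¹ * δ ^ (α : ℝ) := by
          rwa [mul_assoc, inv_mul_cancel₀ hδα.ne', mul_one]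
      _ ≤ 2 * R * (δ ^ (α : ℝ))⁻¹ * dist x y ^ (α : ℝ) := by gcongr
      _ ≤ D * dist x y ^ (α : ℝ) := by
          gcongr
          refine (Real.le_coe_toNNReal _).trans ?_
          exact_mod_cast (le_add_of_nonneg_left (by positivity) :
            (2 * R * (δ ^ (α : ℝ))⁻¹).toNNReal ≤ D)

end LocalHolder

/-! ### Hölder continuity of the logarithm of the Jacobian -/

section LogJacobian

variable {n : ℕ}

/-- In coordinates the determinant is a polynomial in the matrix entries. -/
theorem contDiff_continuousLinearMap_det {m : WithTop ℕ∞} :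
    ContDiff ℝ m (ContinuousLinearMap.det :
      (EuclideanSpace ℝ (Fin n) →L[ℝ] EuclideanSpace ℝ (Fin n)) → ℝ) := by
  have : (ContinuousLinearMap.det :
      (EuclideanSpace ℝ (Fin n) →L[ℝ] EuclideanSpace ℝ (Fin n)) → ℝ) = fun A ↦
      (Matrix.of fun i j ↦ (A (EuclideanSpace.basisFun (Fin n) ℝ j)) i).det := by
    ext A
    rw [ContinuousLinearMap.det, ← LinearMap.det_toMatrix
      (EuclideanSpace.basisFun (Fin n) ℝ).toBasis]
    congr 1
    ext i j
    simp [LinearMap.toMatrix_apply]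
  rw [this]
  simp only [Matrix.det_apply]
  refine ContDiff.sum fun σ _ ↦ ContDiff.const_smul _ (contDiff_prod fun i _ ↦ ?_)
  exact ((EuclideanSpace.proj (𝕜 := ℝ) (σ i)).contDiff).comp
    (contDiff_id.clm_apply contDiff_const)

variable {M : Type*} [TopologicalSpace M] [ChartedSpace (EuclideanSpace ℝ (Fin n)) M]

variable (n) in
/-- The function `h` is locally Hölder continuous at `x` when read in the chart around `x`. -/
def ChartHolderAt (α : ℝ≥0) (h : M → ℝ) (x : M) : Prop :=
  HolderNear α (h ∘ (chartAt (EuclideanSpace ℝ (Fin n)) x).symm)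
    (chartAt (EuclideanSpace ℝ (Fin n)) x x)

theorem ChartHolderAt.add {α : ℝ≥0} {h k : M → ℝ} {x : M} (hh : ChartHolderAt n α h x)
    (hk : ChartHolderAt n α k x) : ChartHolderAt n α (fun z ↦ h z + k z) x :=
  HolderNear.add hh hk

theorem ChartHolderAt.continuousAt {α : ℝ≥0} (hα : 0 < α) {h : M → ℝ} {x : M}
    (hh : ChartHolderAt n α h x) : ContinuousAt h x := by
  set e := chartAt (EuclideanSpace ℝ (Fin n)) x
  have hx : x ∈ e.source := mem_chart_source _ _
  have h1 : ContinuousAt (h ∘ e.symm) (e x) := HolderNear.continuousAt hh hα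
  have h2 : ContinuousAt ((h ∘ e.symm) ∘ e) x := h1.comp (e.continuousAt hx)
  refine h2.congr ?_
  filter_upwards [e.open_source.mem_nhds hx] with z hz
  simp [e.left_inv hz]

theorem contDiffAt_chartAt_comp {f : M → M} {x : M} (hf : ContMDiffAt (𝓡 n) (𝓡 n) 1 f x) :
    ContDiffAt ℝ 1 (chartAt (EuclideanSpace ℝ (Fin n)) (f x) ∘ f ∘
      (chartAt (EuclideanSpace ℝ (Fin n)) x).symm) (chartAt (EuclideanSpace ℝ (Fin n)) x x) := by
  have := (contMDiffAt_iff.1 hf).2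
  simpa [contDiffWithinAt_univ] using this

theorem ChartHolderAt.comp {α : ℝ≥0} {h : M → ℝ} {f : M → M} {x : M}
    (hh : ChartHolderAt n α h (f x)) (hf : ContMDiffAt (𝓡 n) (𝓡 n) 1 f x) :
    ChartHolderAt n α (fun z ↦ h (f z)) x := by
  set e := chartAt (EuclideanSpace ℝ (Fin n)) x
  set e' := chartAt (EuclideanSpace ℝ (Fin n)) (f x)
  have hx : x ∈ e.source := mem_chart_source _ _
  have hF : HolderNear 1 (e' ∘ f ∘ e.symm) (e x) := (contDiffAt_chartAt_comp hf).holderNear_one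
  have hh' : HolderNear α (h ∘ e'.symm) ((e' ∘ f ∘ e.symm) (e x)) := by
    simp only [Function.comp_apply, e.left_inv hx]
    exact hh
  refine (hh'.comp_lipschitz hF).congr ?_
  have hc : ContinuousAt (f ∘ e.symm) (e x) := by
    refine ContinuousAt.comp ?_ (e.continuousAt_symm (e.map_source hx))
    rw [e.left_inv hx]
    exact hf.continuousAt
  have hmem : e'.source ∈ 𝓝 ((f ∘ e.symm) (e x)) := by
    simp only [Function.comp_apply, e.left_inv hx]
    exact chart_source_mem_nhds _ _
  filter_upwards [hc hmem] with u hu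
  exact congrArg h (e'.left_inv hu)

variable [IsManifold (𝓡 n) ∞ M] [RiemannianBundle (fun x : M ↦ TangentSpace (𝓡 n) x)]
  [IsContMDiffRiemannianBundle (𝓡 n) ∞ (EuclideanSpace ℝ (Fin n))
    (fun x : M ↦ TangentSpace (𝓡 n) x)]

theorem contDiffAt_log_sqrt_det_metricMatrix (x : M) {u : EuclideanSpace ℝ (Fin n)}
    (hu : u ∈ (chartAt (EuclideanSpace ℝ (Fin n)) x).target) :
    ContDiffAt ℝ 1 (fun u ↦ Real.log √(metricMatrix x u).det) u := by
  have h1 : ContDiffAt ℝ 1 (fun u ↦ (metricMatrix x u).det) u :=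
    ((contDiffOn_det_metricMatrix x).contDiffAt
      ((chartAt _ x).open_target.mem_nhds hu)).of_le (by exact_mod_cast le_top)
  have hp := det_metricMatrix_pos x hu
  exact (h1.sqrt hp.ne').log (Real.sqrt_pos.2 hp).ne'

/-- The logarithm of the Jacobian of a `C^{1+α}` local diffeomorphism is `α`-Hölder in charts. -/
theorem IsHolderLocalDiffeo.chartHolderAt_log_jacobian {α : ℝ≥0} (hα₀ : 0 < α) (hα₁ : α ≤ 1)
    {f : M → M} (hf : IsHolderLocalDiffeo (n := n) α f) (x : M) :
    ChartHolderAt n α (fun z ↦ Real.log (jacobian (n := n) f z)) x := by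
  set e := chartAt (EuclideanSpace ℝ (Fin n)) x
  set e' := chartAt (EuclideanSpace ℝ (Fin n)) (f x)
  set F := e' ∘ f ∘ e.symm
  have hx : x ∈ e.source := mem_chart_source _ _
  have hd := hf.isLocalDiffeomorph.mdifferentiable one_ne_zero
  have hFx : F (e x) = e' (f x) := by simp [F, e.left_inv hx]
  have hF : ContDiffAt ℝ 1 F (e x) :=
    contDiffAt_chartAt_comp hf.isLocalDiffeomorph.contMDiff.contMDiffAt
  have hev : ∀ᶠ u in 𝓝 (e x), u ∈ e.target ∧ f (e.symm u) ∈ e'.source := by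
    have hc : ContinuousAt (f ∘ e.symm) (e x) :=
      hd.continuous.continuousAt.comp (e.continuousAt_symm (e.map_source hx))
    have hmem : e'.source ∈ 𝓝 ((f ∘ e.symm) (e x)) := by
      simp only [Function.comp_apply, e.left_inv hx]
      exact chart_source_mem_nhds _ _
    exact Filter.inter_mem (e.open_target.mem_nhds (e.map_source hx)) (hc hmem)
  have hJpos : ∀ z, 0 < jacobian (n := n) f z :=
    hf.isLocalDiffeomorph.jacobian_pos
  have hdet : ∀ u, u ∈ e.target ∧ f (e.symm u) ∈ e'.source → (fderiv ℝ F u).det ≠ 0 := by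
    intro u hu h0
    have h1 := jacobian_mul_sqrt_det_metricMatrix_eq (y := f x) hu.1 (hd _) hu.2
    have h2 := mul_pos (hJpos (e.symm u)) (Real.sqrt_pos.2 (det_metricMatrix_pos x hu.1))
    rw [h1, show (fderiv ℝ (e' ∘ f ∘ e.symm) u).det = 0 from h0, abs_zero, zero_mul] at h2
    exact lt_irrefl _ h2
  -- In charts, `log J` is the sum of `log |det DF|` and the log density at the image, minus the log
  -- density at the source. The densities are smooth, so only this term limits the exponent to `α`.
  -- No absolute value is needed because `Real.log` is even.
  have h1 : HolderNear α (fun u ↦ Real.log (fderiv ℝ F u).det) (e x) := by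
    have hDF : HolderNear α (fderiv ℝ F) (e x) := hf.holder_fderiv x
    have hlog : ContDiffAt ℝ 1 (fun A : EuclideanSpace ℝ (Fin n) →L[ℝ] EuclideanSpace ℝ (Fin n) ↦
        Real.log A.det) (fderiv ℝ F (e x)) :=
      contDiff_continuousLinearMap_det.contDiffAt.log (hdet _ hev.self_of_nhds)
    exact hlog.holderNear_one.lipschitz_comp hα₀ hDF
  have h2 : HolderNear α (fun u ↦ Real.log √(metricMatrix (f x) (F u)).det) (e x) := by
    refine HolderNear.of_one hα₁ (ContDiffAt.holderNear_one ?_)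
    refine ContDiffAt.comp (e x) (contDiffAt_log_sqrt_det_metricMatrix (f x) ?_) hF
    rw [hFx]
    exact mem_chart_target _ _
  have h3 : HolderNear α (fun u ↦ Real.log √(metricMatrix x u).det) (e x) :=
    HolderNear.of_one hα₁
      (contDiffAt_log_sqrt_det_metricMatrix x (mem_chart_target _ _)).holderNear_one
  refine ((h1.add h2).add h3.neg).congr ?_
  filter_upwards [hev] with u hu
  have hρ := Real.sqrt_pos.2 (det_metricMatrix_pos x hu.1)
  have hρ' := Real.sqrt_pos.2 (det_metricMatrix_pos (f x) (e'.map_source hu.2))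
  have := congrArg Real.log (jacobian_mul_sqrt_det_metricMatrix_eq (y := f x) hu.1 (hd _) hu.2)
  rw [Real.log_mul (hJpos _).ne' hρ.ne', Real.log_mul (abs_pos.2 (hdet u hu)).ne' hρ'.ne',
    Real.log_abs] at this
  change Real.log (fderiv ℝ (e' ∘ f ∘ e.symm) u).det +
    Real.log √(metricMatrix (f x) (e' (f (e.symm u)))).det + -Real.log √(metricMatrix x u).det =
      Real.log (jacobian (n := n) f (e.symm u))
  linarith

end LogJacobian


/-! ### Lifting paths through an expanding covering -/

section PathLifting

variable {n : ℕ} {M : Type*} [TopologicalSpace M] [ChartedSpace (EuclideanSpace ℝ (Fin n)) M]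

/-- A continuous lift of a `C^1` path under a local diffeomorphism is `C^1`. -/
theorem contMDiffOn_lift {g : M → M} (hg : IsLocalDiffeomorph (𝓡 n) (𝓡 n) 1 g) {γ Γ : ℝ → M}
    {s : Set ℝ} (hγ : ContMDiffOn 𝓘(ℝ) (𝓡 n) 1 γ s) (hΓ : ContinuousOn Γ s)
    (h : ∀ t ∈ s, g (Γ t) = γ t) : ContMDiffOn 𝓘(ℝ) (𝓡 n) 1 Γ s := by
  intro t ht
  obtain ⟨Φ, hΦt, hΦ⟩ := hg (Γ t)
  have hmem : γ t ∈ Φ.target := by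
    rw [← h t ht, hΦ hΦt]
    exact Φ.map_source hΦt
  have h1 : ContMDiffAt (𝓡 n) (𝓡 n) 1 Φ.symm (γ t) :=
    (Φ.contMDiffOn_invFun).contMDiffAt (Φ.open_target.mem_nhds hmem)
  have h2 : ContMDiffWithinAt 𝓘(ℝ) (𝓡 n) 1 (Φ.symm ∘ γ) s t :=
    h1.comp_contMDiffWithinAt t (hγ t ht)
  have h3 : ∀ t' ∈ s, Γ t' ∈ Φ.source → Γ t' = (Φ.symm ∘ γ) t' := fun t' ht' hΓt' ↦ by
    rw [Function.comp_apply, ← h t' ht', hΦ hΓt']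
    exact (Φ.left_inv hΓt').symm
  refine h2.congr_of_eventuallyEq ?_ (h3 t ht hΦt)
  filter_upwards [hΓ t ht (Φ.open_source.mem_nhds hΦt), self_mem_nhdsWithin] with t' ht' hs
  exact h3 t' hs ht'

variable [RiemannianBundle (fun x : M ↦ TangentSpace (𝓡 n) x)]

theorem mul_pathELength_le_of_lift {g : M → M} (hg : IsLocalDiffeomorph (𝓡 n) (𝓡 n) 1 g)
    {κ : ℝ≥0} (hκ : ∀ x, ∀ v : TangentSpace (𝓡 n) x, κ * ‖v‖ₑ ≤ ‖mfderiv (𝓡 n) (𝓡 n) g x v‖ₑ)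
    {γ Γ : ℝ → M} (hΓ : ContMDiffOn 𝓘(ℝ) (𝓡 n) 1 Γ (Icc 0 1))
    (h : ∀ t ∈ Icc (0 : ℝ) 1, g (Γ t) = γ t) :
    κ * Manifold.pathELength (𝓡 n) Γ 0 1 ≤ Manifold.pathELength (𝓡 n) γ 0 1 := by
  rw [← Manifold.pathELength_congr (γ := g ∘ Γ) (γ' := γ) h,
    Manifold.pathELength_eq_lintegral_mfderivWithin_Icc,
    Manifold.pathELength_eq_lintegral_mfderivWithin_Icc,
    ← lintegral_const_mul' _ _ ENNReal.coe_ne_top]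
  refine setLIntegral_mono' measurableSet_Icc fun t ht ↦ ?_
  have hu : UniqueMDiffWithinAt 𝓘(ℝ) (Icc (0 : ℝ) 1) t := by
    rw [uniqueMDiffWithinAt_iff_uniqueDiffWithinAt]
    exact uniqueDiffOn_Icc zero_lt_one t ht
  have hc := mfderiv_comp_mfderivWithin t (hg.mdifferentiable one_ne_zero (Γ t))
    (hΓ.mdifferentiableOn one_ne_zero t ht) hu
  have hc1 : mfderivWithin 𝓘(ℝ) (𝓡 n) (g ∘ Γ) (Icc 0 1) t 1 =
      mfderiv (𝓡 n) (𝓡 n) g (Γ t) (mfderivWithin 𝓘(ℝ) (𝓡 n) Γ (Icc 0 1) t 1) := by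
    rw [hc]; rfl
  rw [hc1]
  exact hκ _ _

/-- Lifting a short path through an expanding covering pairs the points of two fibers. -/
theorem exists_fiber_equiv {g : M → M} (hg : IsLocalDiffeomorph (𝓡 n) (𝓡 n) 1 g)
    (cov : IsCoveringMap g) {κ : ℝ≥0}
    (hκ : ∀ x, ∀ v : TangentSpace (𝓡 n) x, κ * ‖v‖ₑ ≤ ‖mfderiv (𝓡 n) (𝓡 n) g x v‖ₑ)
    {y y' : M} {r : ℝ≥0∞} (hr : Manifold.riemannianEDist (𝓡 n) y y' < r) :
    ∃ σ : g ⁻¹' {y} ≃ g ⁻¹' {y'}, ∀ x : g ⁻¹' {y},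
      κ * Manifold.riemannianEDist (𝓡 n) (x : M) (σ x) ≤ r := by
  obtain ⟨γ, hγ0, hγ1, hγ, hlen⟩ := Manifold.exists_lt_of_riemannianEDist_lt hr
  let c : Path y y' :=
    { toFun := fun t ↦ γ t
      continuous_toFun := hγ.continuousOn.domRestrict
      source' := hγ0
      target' := hγ1 }
  -- Monodromy along one path gives a bijection of whole fibers, as needed to match the sums
  -- defining the transfer operator.
  refine ⟨Equiv.ofBijective (cov.monodromy ⟦c⟧) (cov.monodromy_bijective _), fun x ↦ ?_⟩
  have hx : c 0 = g x := c.source.trans x.2.symm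
  set L := cov.liftPath c x hx
  have hσ : ((Equiv.ofBijective (cov.monodromy ⟦c⟧)
      (cov.monodromy_bijective _) x : g ⁻¹' {y'}) : M) = L 1 := rfl
  rw [hσ]
  -- Path length is defined for maps on `ℝ`, so the lift is extended constantly outside the unit
  -- interval.
  set Γ : ℝ → M := fun t ↦ L (projIcc 0 1 zero_le_one t)
  have hΓc : Continuous Γ := L.continuous.comp continuous_projIcc
  have hlift : ∀ t ∈ Icc (0 : ℝ) 1, g (Γ t) = γ t := fun t ht ↦ by
    have := congrFun (cov.liftPath_lifts c x hx) (projIcc 0 1 zero_le_one t)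
    rw [Function.comp_apply] at this
    simp only [Γ, L, this]
    rw [projIcc_of_mem zero_le_one ht]
    rfl
  have hΓ := contMDiffOn_lift hg hγ hΓc.continuousOn hlift
  calc κ * Manifold.riemannianEDist (𝓡 n) (x : M) (L 1)
      ≤ κ * Manifold.pathELength (𝓡 n) Γ 0 1 := by
        gcongr
        refine Manifold.riemannianEDist_le_pathELength hΓ ?_ ?_ zero_le_one
        · simp [Γ, L, cov.liftPath_zero]
        · simp [Γ]
    _ ≤ Manifold.pathELength (𝓡 n) γ 0 1 := mul_pathELength_le_of_lift hg hκ hΓ hlift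
    _ ≤ r := hlen.le

end PathLifting

/-! ### Comparison of charts with the Riemannian distance -/

section ChartLipschitz

variable {E : Type*} [NormedAddCommGroup E] [NormedSpace ℝ E]
  {H : Type*} [TopologicalSpace H] {I : ModelWithCorners ℝ E H}
  {M : Type*} [PseudoEMetricSpace M] [ChartedSpace H M]
  [RiemannianBundle (fun x : M ↦ TangentSpace I x)]
  [IsManifold I 1 M] [IsContinuousRiemannianBundle E (fun x : M ↦ TangentSpace I x)]

theorem eventually_enorm_mfderiv_extChartAt_apply_le (x : M) :
    ∃ C > (0 : ℝ≥0), ∀ᶠ y in 𝓝 x, ∀ v : TangentSpace I y,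
      ‖(show E from mfderiv I 𝓘(ℝ, E) (extChartAt I x) y v)‖ₑ ≤ C * ‖v‖ₑ := by
  obtain ⟨C, hC0, hC⟩ := eventually_enorm_mfderiv_extChartAt_lt I x
  refine ⟨C, hC0, ?_⟩
  filter_upwards [hC] with y hy v
  exact (@ContinuousLinearMap.le_opENorm ℝ ℝ (TangentSpace I y) E _ _ _ _ _ _ _ _ _ v).trans
    (mul_le_mul_left hy.le _)

variable [IsRiemannianManifold I M]

/-- The charts of a Riemannian manifold are locally Lipschitz for the Riemannian distance. -/
theorem holderNear_extChartAt (x : M) : HolderNear 1 (extChartAt I x) x := by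
  obtain ⟨C, hC0, hC⟩ := eventually_enorm_mfderiv_extChartAt_apply_le (I := I) x
  obtain ⟨r, hr, hrU⟩ := EMetric.mem_nhds_iff.1
    (Filter.inter_mem hC (chart_source_mem_nhds H x))
  -- A path of length below `2 * (r / 3)` starting in the ball of radius `r / 3` stays in the ball
  -- of radius `r`, where the derivative bound holds.
  refine ⟨C, Metric.eball x (r / 3), Metric.eball_mem_nhds x (ENNReal.div_pos hr.ne' (by simp)),
    holderOnWith_one.2 fun y hy z hz ↦ ?_⟩
  by_contra! hlt
  have hyz : edist y z < 2 * (r / 3) := by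
    calc edist y z ≤ edist y x + edist z x := edist_triangle_right _ _ _
      _ < r / 3 + r / 3 := ENNReal.add_lt_add hy hz
      _ = 2 * (r / 3) := by ring
  have hB : edist y z < edist (extChartAt I x y) (extChartAt I x z) / C := by
    rw [ENNReal.lt_div_iff_mul_lt (.inl (by exact_mod_cast hC0.ne')) (.inl ENNReal.coe_ne_top),
      mul_comm]
    exact hlt
  -- A path of length below `R` both stays in the good ball and is too short for the assumed failure
  -- of the Lipschitz bound.
  obtain ⟨R, hR1, hR2⟩ := exists_between (lt_min hyz hB)
  rw [IsRiemannianManifold.out (I := I) y z] at hR1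
  obtain ⟨γ, hγ0, hγ1, hγ, hlen⟩ := Manifold.exists_lt_of_riemannianEDist_lt hR1
  have hγU : ∀ t ∈ Icc (0 : ℝ) 1, (∀ v : TangentSpace I (γ t),
      ‖(show E from mfderiv I 𝓘(ℝ, E) (extChartAt I x) (γ t) v)‖ₑ ≤ C * ‖v‖ₑ) ∧
      γ t ∈ (chartAt H x).source := by
    intro t ht
    refine hrU ?_
    have h1 : edist y (γ t) ≤ Manifold.pathELength I γ 0 1 := by
      rw [IsRiemannianManifold.out (I := I) y (γ t)]
      exact (Manifold.riemannianEDist_le_pathELength (hγ.mono (Icc_subset_Icc_right ht.2)) hγ0 rfl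
        ht.1).trans (Manifold.pathELength_mono le_rfl ht.2)
    rw [Metric.mem_eball]
    calc edist (γ t) x ≤ edist y (γ t) + edist y x := by
          rw [edist_comm y (γ t)]
          exact edist_triangle _ _ _
      _ < 2 * (r / 3) + r / 3 :=
          ENNReal.add_lt_add (h1.trans_lt (hlen.trans (hR2.trans_le (min_le_left _ _)))) hy
      _ = r := by
          rw [← add_one_mul, show (2 : ℝ≥0∞) + 1 = 3 by norm_num]
          exact ENNReal.mul_div_cancel (by simp) (by simp)
  have hcomp : ContMDiffOn 𝓘(ℝ) 𝓘(ℝ, E) 1 (extChartAt I x ∘ γ) (Icc 0 1) :=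
    contMDiffOn_extChartAt.comp (I' := I) (t := (chartAt H x).source) hγ
      (fun t ht ↦ (hγU t ht).2)
  have key : edist (extChartAt I x y) (extChartAt I x z) ≤ C * R := by
    calc edist (extChartAt I x y) (extChartAt I x z)
        = ‖(extChartAt I x ∘ γ) 1 - (extChartAt I x ∘ γ) 0‖ₑ := by
          rw [edist_comm, edist_eq_enorm_sub, Function.comp_apply, Function.comp_apply, hγ0, hγ1]
      _ ≤ ∫⁻ t in Icc 0 1, ‖derivWithin (extChartAt I x ∘ γ) (Icc 0 1) t‖ₑ :=
          enorm_sub_le_lintegral_derivWithin_Icc_of_contDiffOn_Icc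
            (contMDiffOn_iff_contDiffOn.1 hcomp) zero_le_one
      _ = ∫⁻ t in Icc 0 1,
          ‖(show E from
            mfderivWithin 𝓘(ℝ) 𝓘(ℝ, E) (extChartAt I x ∘ γ) (Icc 0 1) t (1 : ℝ))‖ₑ := by
          simp_rw [← fderivWithin_derivWithin, mfderivWithin_eq_fderivWithin]
          rfl
      _ ≤ ∫⁻ t in Icc 0 1, C * ‖mfderivWithin 𝓘(ℝ) I γ (Icc 0 1) t 1‖ₑ := by
          refine setLIntegral_mono' measurableSet_Icc fun t ht ↦ ?_
          have hu : UniqueMDiffWithinAt 𝓘(ℝ) (Icc (0 : ℝ) 1) t := by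
            rw [uniqueMDiffWithinAt_iff_uniqueDiffWithinAt]
            exact uniqueDiffOn_Icc zero_lt_one t ht
          have h1 := mfderiv_comp_mfderivWithin t
            (mdifferentiableAt_extChartAt (I := I) (hγU t ht).2)
            (hγ.mdifferentiableOn one_ne_zero t ht) hu
          have h2 : mfderivWithin 𝓘(ℝ) 𝓘(ℝ, E) (extChartAt I x ∘ γ) (Icc 0 1) t 1 =
              mfderiv I 𝓘(ℝ, E) (extChartAt I x) (γ t)
                (mfderivWithin 𝓘(ℝ) I γ (Icc 0 1) t 1) := congr($h1 1)
          exact (congrArg (fun w : E ↦ ‖w‖ₑ) h2).trans_le ((hγU t ht).1 _)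
      _ = C * Manifold.pathELength I γ 0 1 := by
          rw [lintegral_const_mul' _ _ ENNReal.coe_ne_top,
            Manifold.pathELength_eq_lintegral_mfderivWithin_Icc]
      _ ≤ C * R := by gcongr
  have hR3 : R < edist (extChartAt I x y) (extChartAt I x z) / C := hR2.trans_le (min_le_right _ _)
  rw [ENNReal.lt_div_iff_mul_lt (.inl (by exact_mod_cast hC0.ne')) (.inl ENNReal.coe_ne_top),
    mul_comm] at hR3
  exact (key.trans_lt hR3).false

end ChartLipschitz


/-! ### Regularity and Jacobian of the orbital branch -/

section OrbitalBranch

/-- The index starts at `k + 1` because the generated semigroup need not contain the identity. -/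
theorem orbitalBranch_mem_generatedSemigroup {M ι : Type*} (f : ι → M → M) (w : ℕ → ι) (k : ℕ) :
    (orbitalBranch f w (k + 1) : Function.End M) ∈ generatedSemigroup f := by
  induction k with
  | zero => exact Subsemigroup.subset_closure ⟨w 0, rfl⟩
  | succ k ih =>
    exact (generatedSemigroup f).mul_mem (x := (f (w (k + 1)) : Function.End M))
      (Subsemigroup.subset_closure ⟨w (k + 1), rfl⟩) ih

variable {n : ℕ} {M : Type*} [TopologicalSpace M] [ChartedSpace (EuclideanSpace ℝ (Fin n)) M]
  {ι : Type*} {f : ι → M → M}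

theorem isLocalDiffeomorph_orbitalBranch (hf : ∀ i, IsLocalDiffeomorph (𝓡 n) (𝓡 n) 1 (f i))
    (w : ℕ → ι) (k : ℕ) : IsLocalDiffeomorph (𝓡 n) (𝓡 n) 1 (orbitalBranch f w k) := by
  induction k with
  | zero => exact (Diffeomorph.refl (𝓡 n) M 1).isLocalDiffeomorph
  | succ k ih => exact fun x ↦ (ih x).comp (𝓡 n) M (hf (w k) _)

theorem measurable_of_chartHolderAt [MeasurableSpace M] [BorelSpace M] {α : ℝ≥0} (hα : 0 < α) {φ : M → ℝ}
    (hφ : ∀ x, ChartHolderAt n α φ x) : Measurable φ :=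
  (continuous_iff_continuousAt.2 fun x ↦ (hφ x).continuousAt hα).measurable

variable [IsManifold (𝓡 n) ∞ M] [RiemannianBundle (fun x : M ↦ TangentSpace (𝓡 n) x)]
  [IsContMDiffRiemannianBundle (𝓡 n) ∞ (EuclideanSpace ℝ (Fin n))
    (fun x : M ↦ TangentSpace (𝓡 n) x)]
  [PolishSpace M] [MeasurableSpace M] [BorelSpace M]

/-- By the chain rule `φ` is the sum of the log-Jacobians of the letters along the orbit; composing
with `C^1` maps and adding preserve the Hölder exponent. -/
theorem exists_hasLogJacobian_orbitalBranch {α : ℝ≥0} (hα₀ : 0 < α) (hα₁ : α ≤ 1)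
    (hf : ∀ i, IsHolderLocalDiffeo (n := n) α (f i)) (w : ℕ → ι) (k : ℕ) :
    ∃ φ : M → ℝ, HasLogJacobian (riemannianVolume n M) (orbitalBranch f w k) φ ∧
      ∀ x, ChartHolderAt n α φ x := by
  induction k with
  | zero =>
    refine ⟨fun _ ↦ 0, fun x ↦ ⟨univ, Filter.univ_mem, injOn_id _, fun S _ _ ↦ ?_⟩, fun x ↦
      ⟨0, univ, Filter.univ_mem, fun _ _ _ _ ↦ by simp⟩⟩
    simp [orbitalBranch]
  | succ k ih =>
    obtain ⟨φ, hφ, hφα⟩ := ih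
    have hk := isLocalDiffeomorph_orbitalBranch (fun i ↦ (hf i).isLocalDiffeomorph) w k
    have hkc : Continuous (orbitalBranch f w k) := hk.contMDiff.continuous
    have hχα := (hf (w k)).chartHolderAt_log_jacobian hα₀ hα₁
    have hχm := measurable_of_chartHolderAt hα₀ hχα
    have hJ : Measurable (jacobian (n := n) (f (w k))) := by
      have : jacobian (n := n) (f (w k)) =
          fun z ↦ Real.exp (Real.log (jacobian (n := n) (f (w k)) z)) :=
        funext fun z ↦ (Real.exp_log ((hf (w k)).isLocalDiffeomorph.jacobian_pos z)).symm
      rw [this]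
      exact hχm.exp
    refine ⟨_, (hasLogJacobian_riemannianVolume (hf (w k)).isLocalDiffeomorph hJ).comp hφ hkc
      (measurable_of_chartHolderAt hα₀ hφα) hχm
      (fun S hS hi ↦ measurableSet_image_of_injOn hkc hS hi), fun x ↦ ?_⟩
    exact ((hχα _).comp hk.contMDiff.contMDiffAt).add (hφα x)

end OrbitalBranch

/-! ### Contraction of fibers and ergodicity -/

section Ergodicity

theorem isContinuousRiemannianBundle_of_isContMDiffRiemannianBundle {n : ℕ} {M : Type*}
    [TopologicalSpace M] [ChartedSpace (EuclideanSpace ℝ (Fin n)) M] [IsManifold (𝓡 n) ∞ M]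
    [RiemannianBundle (fun x : M ↦ TangentSpace (𝓡 n) x)]
    [h : IsContMDiffRiemannianBundle (𝓡 n) ∞ (EuclideanSpace ℝ (Fin n))
      (fun x : M ↦ TangentSpace (𝓡 n) x)] :
    IsContinuousRiemannianBundle (EuclideanSpace ℝ (Fin n))
      (fun x : M ↦ TangentSpace (𝓡 n) x) := by
  obtain ⟨g, hg, hinner⟩ := h.exists_contMDiff
  exact ⟨g, hg.continuous, hinner⟩

variable {n : ℕ} {M : Type*} [MetricSpace M] [ChartedSpace (EuclideanSpace ℝ (Fin n)) M]
  [RiemannianBundle (fun x : M ↦ TangentSpace (𝓡 n) x)] [IsRiemannianManifold (𝓡 n) M]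

/-- The points of any two fibers of an expanding local diffeomorphism can be paired in such a way
that the distances are contracted. -/
theorem exists_fiber_equiv_dist_le [CompactSpace M] {g : M → M}
    (hg : IsLocalDiffeomorph (𝓡 n) (𝓡 n) 1 g) {κ θ : ℝ} (hκ₀ : 0 < κ) (hκθ : 1 < κ * θ)
    (hκ : ∀ x, ∀ v : TangentSpace (𝓡 n) x, κ * ‖v‖ ≤ ‖mfderiv (𝓡 n) (𝓡 n) g x v‖) (y y' : M) :
    ∃ σ : g ⁻¹' {y} ≃ g ⁻¹' {y'}, ∀ x : g ⁻¹' {y}, dist (x : M) (σ x) ≤ θ * dist y y' := by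
  rcases eq_or_ne y y' with rfl | hne
  · exact ⟨Equiv.refl _, fun x ↦ by simp⟩
  have cov : IsCoveringMap g := isLocalHomeomorph_iff_isCoveringMap.1 hg.isLocalHomeomorph
  have hκ' : ∀ x, ∀ v : TangentSpace (𝓡 n) x,
      (κ.toNNReal : ℝ≥0∞) * ‖v‖ₑ ≤ ‖mfderiv (𝓡 n) (𝓡 n) g x v‖ₑ := fun x v ↦ by
    rw [← ofReal_norm, ← ofReal_norm, ← ENNReal.ofReal, ← ENNReal.ofReal_mul hκ₀.le]
    exact ENNReal.ofReal_le_ofReal (hκ x v)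
  -- The distance is an infimum of lengths that need not be attained; the slack in `1 < κ * θ`
  -- leaves room for an almost shortest path once `y ≠ y'`.
  have hlt : Manifold.riemannianEDist (𝓡 n) y y' < ENNReal.ofReal (κ * θ * dist y y') := by
    rw [← IsRiemannianManifold.out (I := 𝓡 n) y y', edist_dist]
    have := dist_pos.2 hne
    exact (ENNReal.ofReal_lt_ofReal_iff (by positivity)).2 (by nlinarith)
  obtain ⟨σ, hσ⟩ := exists_fiber_equiv hg cov hκ' hlt
  refine ⟨σ, fun x ↦ ?_⟩
  have h1 := hσ x
  rw [← IsRiemannianManifold.out (I := 𝓡 n) (x : M) (σ x), edist_dist, ← ENNReal.ofReal,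
    ← ENNReal.ofReal_mul hκ₀.le,
    ENNReal.ofReal_le_ofReal_iff (by have := dist_nonneg (x := y) (y := y'); positivity),
    mul_assoc] at h1
  exact le_of_mul_le_mul_left h1 hκ₀

theorem ChartHolderAt.holderNear [IsManifold (𝓡 n) ∞ M]
    [IsContinuousRiemannianBundle (EuclideanSpace ℝ (Fin n)) (fun x : M ↦ TangentSpace (𝓡 n) x)]
    {α : ℝ≥0} {φ : M → ℝ} {x : M} (hφ : ChartHolderAt n α φ x) : HolderNear α φ x := by
  have h1 : HolderNear 1 (chartAt (EuclideanSpace ℝ (Fin n)) x) x :=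
    holderNear_extChartAt (I := 𝓡 n) x
  refine (HolderNear.comp_lipschitz hφ h1).congr ?_
  filter_upwards [chart_source_mem_nhds (EuclideanSpace ℝ (Fin n)) x] with z hz
  exact congrArg φ ((chartAt (EuclideanSpace ℝ (Fin n)) x).left_inv hz)

theorem isErgodicAction_of_isUniformlyExpanding [IsManifold (𝓡 n) ∞ M]
    [CompactSpace M] [Nonempty M]
    [IsContMDiffRiemannianBundle (𝓡 n) ∞ (EuclideanSpace ℝ (Fin n))
      (fun x : M ↦ TangentSpace (𝓡 n) x)]
    [MeasurableSpace M] [BorelSpace M] {ι : Type*} {f : ι → M → M} {α : ℝ≥0} (hα₀ : 0 < α)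
    (hα₁ : α ≤ 1) (hf : ∀ i, IsHolderLocalDiffeo (n := n) α (f i))
    (hexp : IsUniformlyExpanding (n := n) f) :
    IsErgodicAction (generatedSemigroup f) (lebesgueMeasure n M) := by
  have : IsContinuousRiemannianBundle (EuclideanSpace ℝ (Fin n))
      (fun x : M ↦ TangentSpace (𝓡 n) x) :=
    isContinuousRiemannianBundle_of_isContMDiffRiemannianBundle
  intro A hA hinv
  obtain ⟨w, lam, C, hlam, hC, hwC⟩ := hexp
  have htend : Filter.Tendsto (fun k : ℕ ↦ C * lam ^ k) Filter.atTop Filter.atTop :=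
    (tendsto_pow_atTop_atTop_of_one_lt hlam).const_mul_atTop hC
  obtain ⟨k, hk1, hκ1⟩ := ((Filter.eventually_ge_atTop 1).and
    (htend.eventually_gt_atTop 1)).exists
  set κ := C * lam ^ k
  set g := orbitalBranch f w k
  set μ := riemannianVolume n M
  have hg := isLocalDiffeomorph_orbitalBranch (fun i ↦ (hf i).isLocalDiffeomorph) w k
  obtain ⟨φ, hφ, hφα⟩ := exists_hasLogJacobian_orbitalBranch hα₀ hα₁ hf w k
  obtain ⟨D, hD⟩ := exists_holderWith_of_holderNear hα₀ fun x ↦ (hφα x).holderNear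
  have hμ : IsFiniteMeasure μ := ⟨isCompact_univ.measure_lt_top⟩
  have hμ0 : μ univ ≠ 0 := riemannianVolume_univ_ne_zero
  have hmaps : MapsTo g A A := fun x hx ↦ by
    obtain ⟨j, rfl⟩ := Nat.exists_eq_add_of_le' hk1
    exact hinv _ (orbitalBranch_mem_generatedSemigroup f w j) ⟨x, hx, rfl⟩
  have hκinv : κ⁻¹ < 1 := inv_lt_one_of_one_lt₀ hκ1
  have hκpos : 0 < κ := one_pos.trans hκ1
  -- The midpoint of `κ⁻¹` and `1` is a contraction rate below `1` that still leaves the slack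
  -- required for lifting.
  have hκθ : 1 < κ * ((1 + κ⁻¹) / 2) := by
    have : κ * κ⁻¹ = 1 := mul_inv_cancel₀ hκpos.ne'
    nlinarith
  have hA' : NullMeasurableSet A μ := hA.mono_ac
    (Measure.absolutelyContinuous_smul (ENNReal.inv_ne_zero.2 (measure_ne_top μ univ)))
  have hle : lebesgueMeasure n M ≪ μ := Measure.smul_absolutelyContinuous
  rcases hφ.measure_eq_zero_or_measure_compl_eq_zero hg.contMDiff.continuous
    (θ := (1 + κ⁻¹) / 2) (by positivity) (by linarith) hα₀ hα₁ hD
    (exists_fiber_equiv_dist_le hg hκpos hκθ fun x v ↦ hwC x k hk1 v) hA' hmaps with h | h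
  · exact .inl (hle h)
  · right
    have hAu : A =ᵐ[lebesgueMeasure n M] univ := Filter.eventuallyEq_univ.2 (mem_ae_iff.2 (hle h))
    rw [measure_congr hAu, lebesgueMeasure, Measure.smul_apply, smul_eq_mul,
      ENNReal.inv_mul_cancel hμ0 (measure_ne_top μ univ)]

end Ergodicity

/-- The set of points at finite distance from `x` is open and closed. Connectedness of the manifold
thus makes the Riemannian distance finite, and so lets any two fibers be compared. -/
theorem edist_ne_top_of_preconnectedSpace {X : Type*} [PseudoEMetricSpace X] [PreconnectedSpace X]
    (x y : X) : edist x y ≠ ⊤ := by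
  have hopen : IsOpen (Metric.eball x ⊤) := Metric.isOpen_eball
  have hclosed : IsClosed (Metric.eball x ⊤) := Metric.isClosed_eball_top
  have := IsClopen.eq_univ ⟨hclosed, hopen⟩ ⟨x, Metric.mem_eball_self ENNReal.zero_lt_top⟩
  have hy : y ∈ Metric.eball x ⊤ := this ▸ mem_univ y
  rw [edist_comm]
  exact (Metric.mem_eball.1 hy).ne

end ExpandingAction

end

/-! ### The theorem for the metric induced by the Riemannian structure -/

open ExpandingAction in
theorem theoremA {n : ℕ} {M : Type*} [TopologicalSpace M]
    [ChartedSpace (EuclideanSpace ℝ (Fin n)) M] [IsManifold (𝓡 n) ∞ M]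
    [T2Space M] [CompactSpace M] [ConnectedSpace M]
    [RiemannianBundle (fun x : M ↦ TangentSpace (𝓡 n) x)]
    [IsContMDiffRiemannianBundle (𝓡 n) ∞ (EuclideanSpace ℝ (Fin n))
      (fun x : M ↦ TangentSpace (𝓡 n) x)]
    [MeasurableSpace M] [BorelSpace M]
    {d : ℕ} (f : Fin d → M → M) {α : ℝ≥0} (hα₀ : 0 < α) (hα₁ : α ≤ 1)
    (hf : ∀ i, IsHolderLocalDiffeo (n := n) α (f i))
    (hexp : IsUniformlyExpanding (n := n) f) :
    IsErgodicAction (generatedSemigroup f) (lebesgueMeasure n M) := by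
  have : IsContinuousRiemannianBundle (EuclideanSpace ℝ (Fin n))
      (fun x : M ↦ TangentSpace (𝓡 n) x) :=
    isContinuousRiemannianBundle_of_isContMDiffRiemannianBundle
  let : EMetricSpace M := EMetricSpace.ofRiemannianMetric (𝓡 n) M
  let : MetricSpace M := EMetricSpace.toMetricSpace edist_ne_top_of_preconnectedSpace
  have : IsRiemannianManifold (𝓡 n) M := ⟨fun _ _ ↦ rfl⟩
  exact isErgodicAction_of_isUniformlyExpanding hα₀ hα₁ hf hexp
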